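/- Let $d,L,T>0$. Let $\mathbb T=\mathbb R/(d+2L)\mathbb Z$ be the one-dimensional torus, identified with $(-L,d+L)$ with periodic conditions, and let $\omega=(-L,0)\cup(d,d+L)\subset\mathbb T$, with characteristic function $\chi_\omega$. All functions are real valued. For all $M\ge 0$ and $C_0>0$ there is a constant $C>0$, depending only on $d,L,T,M,C_0$, such that the following holds. Let $a\in L^\infty(\mathbb T\times(0,T))$ with $\|a\|_{L^\infty}\le M$, let $(\beta_0,\beta_1)\in H^3(\mathbb T)\times H^1(\mathbb T)$, and let $v\in L^2(0,T;L^2(\mathbb T))$ satisfy $$\|v\|_{L^2(0,T;L^2(\mathbb T))}\le C_0\,\|(\beta_0,\beta_1)\|_{H^3(\mathbb T)\times H^1(\mathbb T)}.$$ Then the damped beam equation with potential $$\partial_{tt}\beta-\partial_{txx}\beta+\partial_{xxxx}\beta+a\beta=v\,\chi_\omega\ \text{ in }\mathbb T\times(0,T),\qquad \beta(\cdot,0)=\beta_0,\quad \partial_t\beta(\cdot,0)=\beta_1\ \text{ in }\mathbb T,$$ has a unique solution $$\beta\in L^2(0,T;H^4(\mathbb T))\cap H^1(0,T;H^2(\mathbb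 T))\cap H^2(0,T;L^2(\mathbb T)),$$ and this solution satisfies $$\|(\beta,\partial_t\beta)\|_{L^2(0,T;H^4(\mathbb T)\times H^2(\mathbb T))\,\cap\, H^1(0,T;H^2(\mathbb T)\times L^2(\mathbb T))}\le C\,\|(\beta_0,\beta_1)\|_{H^3(\mathbb T)\times H^1(\mathbb T)}.$$ Here the equation holds almost everywhere, with weak derivatives, and the initial values are those of the representatives of $\beta$ and $\partial_t\beta$ that are continuous in time. -/

import Mathlib

open MeasureTheory Set
open scoped ENNReal ContDiff

noncomputable section

namespace DampedBeam

/-! ### Sobolev spaces on a one-dimensional torus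

The torus of length `P` is Mathlib's `AddCircle P = ℝ / Pℤ`, with its Lebesgue measure
(of total mass `P`). -/

/-- `L²` of the torus of length `P` (real valued functions). -/
abbrev L2Torus (P : ℝ) [Fact (0 < P)] : Type :=
  Lp ℝ 2 (volume : Measure (AddCircle P))

/-- `φ` is a `C^∞` function on the torus. -/
def SmoothTorus {P : ℝ} (φ : AddCircle P → ℝ) : Prop :=
  ContDiff ℝ ∞ (fun y : ℝ => φ (y : AddCircle P))

/-- The `k`-th classical derivative of a (smooth) function on the torus: the `k`-th derivative of
the periodic function `y ↦ φ (y mod P)`, read back on the torus. -/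
def torusDeriv {P : ℝ} [Fact (0 < P)] (k : ℕ) (φ : AddCircle P → ℝ) : AddCircle P → ℝ :=
  AddCircle.liftIco P 0 (iteratedDeriv k (fun y : ℝ => φ (y : AddCircle P)))

/-- `g` is the `k`-th weak (distributional) derivative of `f` on the torus. -/
def IsWeakDerivTorus {P : ℝ} [Fact (0 < P)] (k : ℕ) (f g : L2Torus P) : Prop :=
  ∀ φ : AddCircle P → ℝ, SmoothTorus φ →
    ∫ x, f x * torusDeriv k φ x = (-1 : ℝ) ^ k * ∫ x, g x * φ x

theorem SmoothTorus.continuous {P : ℝ} {φ : AddCircle P → ℝ} (h : SmoothTorus φ) :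
    Continuous φ :=
  (QuotientAddGroup.isQuotientMap_mk (N := AddSubgroup.zmultiples P)).continuous_iff.2
    (ContDiff.continuous h)

theorem SmoothTorus.continuous_torusDeriv {P : ℝ} [hP : Fact (0 < P)] {φ : AddCircle P → ℝ}
    (h : SmoothTorus φ) (k : ℕ) : Continuous (torusDeriv k φ) := by
  have hc : Continuous (iteratedDeriv k (fun y : ℝ => φ (y : AddCircle P))) :=
    ContDiff.continuous_iteratedDeriv k h (by exact_mod_cast le_top)
  refine AddCircle.liftIco_continuous ?_ hc.continuousOn
  have e : (fun y : ℝ => φ (y : AddCircle P)) = fun y : ℝ => φ ((y + P : ℝ) : AddCircle P) := by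
    funext y; simp
  have := congrFun (iteratedDeriv_comp_add_const k (fun y : ℝ => φ (y : AddCircle P)) P) 0
  rw [← e] at this
  simpa using this

/-- Pairing with a continuous function is a continuous linear functional on `L²`. -/
theorem exists_pairing {P : ℝ} [Fact (0 < P)] {ψ : AddCircle P → ℝ} (h : Continuous ψ) :
    ∃ l : L2Torus P →L[ℝ] ℝ, ∀ f : L2Torus P, ∫ x, f x * ψ x = l f := by
  have hm : MemLp ψ 2 (volume : Measure (AddCircle P)) := by
    obtain ⟨C, hC⟩ := isCompact_univ.exists_bound_of_continuousOn h.continuousOn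
    exact MemLp.of_bound h.aestronglyMeasurable C (Filter.Eventually.of_forall fun x => hC x trivial)
  refine ⟨innerSL ℝ hm.toLp, fun f => ?_⟩
  rw [innerSL_apply_apply, L2.inner_def]
  refine integral_congr_ae ?_
  filter_upwards [hm.coeFn_toLp] with x hx
  simp [hx]

/-- The Sobolev space `H^m` of the torus. An element is the tuple `(f, f', …, f^(m))` of an
`L²` function together with its weak derivatives up to order `m`, all of them in `L²`; the norm is
`(∑_{k ≤ m} ‖f^(k)‖²)^(1/2)`. -/
def sobolevTorus (P : ℝ) [Fact (0 < P)] (m : ℕ) :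
    Submodule ℝ (PiLp 2 (fun _ : Fin (m + 1) => L2Torus P)) where
  carrier := {g | ∀ k : Fin (m + 1), IsWeakDerivTorus (k : ℕ) (g 0) (g k)}
  zero_mem' := by
    intro k φ hφ
    obtain ⟨l, hl⟩ := exists_pairing (hφ.continuous_torusDeriv k)
    obtain ⟨l', hl'⟩ := exists_pairing hφ.continuous
    rw [hl, hl']; simp
  add_mem' := by
    intro g h hg hh k φ hφ
    have h1 := hg k φ hφ
    have h2 := hh k φ hφ
    obtain ⟨l, hl⟩ := exists_pairing (hφ.continuous_torusDeriv k)
    obtain ⟨l', hl'⟩ := exists_pairing hφ.continuous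
    rw [hl, hl'] at *
    simp only [PiLp.add_apply, map_add, h1, h2]; ring
  smul_mem' := by
    intro c g hg k φ hφ
    have h1 := hg k φ hφ
    obtain ⟨l, hl⟩ := exists_pairing (hφ.continuous_torusDeriv k)
    obtain ⟨l', hl'⟩ := exists_pairing hφ.continuous
    rw [hl, hl'] at *
    simp only [PiLp.smul_apply, map_smul, smul_eq_mul, h1]; ring

/-- `H^m` of the torus, as a type. -/
abbrev HTorus (P : ℝ) [Fact (0 < P)] (m : ℕ) : Type := sobolevTorus P m

theorem isClosed_sobolevTorus (P : ℝ) [Fact (0 < P)] (m : ℕ) :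
    IsClosed (sobolevTorus P m : Set (PiLp 2 (fun _ : Fin (m + 1) => L2Torus P))) := by
  have : (sobolevTorus P m : Set (PiLp 2 (fun _ : Fin (m + 1) => L2Torus P))) =
      ⋂ k : Fin (m + 1), ⋂ φ : AddCircle P → ℝ, ⋂ _ : SmoothTorus φ,
        {g | ∫ x, (g 0) x * torusDeriv k φ x = (-1 : ℝ) ^ (k : ℕ) * ∫ x, (g k) x * φ x} := by
    ext g
    simp only [mem_iInter]
    rfl
  rw [this]
  refine isClosed_iInter fun k => isClosed_iInter fun φ => isClosed_iInter fun hφ => ?_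
  obtain ⟨l, hl⟩ := exists_pairing (hφ.continuous_torusDeriv k)
  obtain ⟨l', hl'⟩ := exists_pairing hφ.continuous
  simp only [hl, hl']
  exact isClosed_eq (by fun_prop) (by fun_prop)

instance completeSpace_sobolevTorus (P : ℝ) [Fact (0 < P)] (m : ℕ) :
    CompleteSpace (sobolevTorus P m) :=
  (isClosed_sobolevTorus P m).completeSpace_coe

/-- The weak derivative `∂_x^k : H^m → L²`, for `k ≤ m`; for `k = 0` it is the inclusion
`H^m ⊆ L²`. -/
def dx {P : ℝ} [Fact (0 < P)] {m : ℕ} (k : Fin (m + 1)) : HTorus P m →L[ℝ] L2Torus P :=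
  (PiLp.proj 2 (fun _ : Fin (m + 1) => L2Torus P) k).comp (sobolevTorus P m).subtypeL

/-! ### Bochner and Sobolev spaces in time -/

/-- The Bochner space `L²(0,T;X)`. -/
abbrev L2Time (T : ℝ) (X : Type) [NormedAddCommGroup X] : Type :=
  Lp X 2 (volume.restrict (Ioo 0 T))

/-- `v` is the `k`-th weak derivative of `u` in `L²(0,T;X)` (`X` is a Banach space, so that the
integrals are genuine Bochner integrals). -/
def IsWeakDerivTime {T : ℝ} {X : Type} [NormedAddCommGroup X] [NormedSpace ℝ X] [CompleteSpace X]
    (k : ℕ) (u v : L2Time T X) : Prop :=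
  ∀ φ : ℝ → ℝ, ContDiff ℝ ∞ φ → HasCompactSupport φ → tsupport φ ⊆ Ioo 0 T →
    ∫ t in Ioo 0 T, iteratedDeriv k φ t • u t = (-1 : ℝ) ^ k • ∫ t in Ioo 0 T, φ t • v t

theorem integrable_test_smul {T : ℝ} {X : Type} [NormedAddCommGroup X] [NormedSpace ℝ X]
    {φ : ℝ → ℝ} (hφ : Continuous φ) (u : L2Time T X) :
    Integrable (fun t => φ t • u t) (volume.restrict (Ioo 0 T)) := by
  have hu : Integrable u (volume.restrict (Ioo 0 T)) := (Lp.memLp u).integrable one_le_two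
  obtain ⟨C, hC⟩ := (isCompact_Icc (a := (0 : ℝ)) (b := T)).exists_bound_of_continuousOn
    hφ.continuousOn
  refine hu.bdd_smul C hφ.aestronglyMeasurable ?_
  filter_upwards [ae_restrict_mem measurableSet_Ioo] with t ht
  exact hC t (Ioo_subset_Icc_self ht)

theorem integral_test_add {T : ℝ} {X : Type} [NormedAddCommGroup X] [NormedSpace ℝ X]
    {φ : ℝ → ℝ} (hφ : Continuous φ) (u v : L2Time T X) :
    ∫ t in Ioo 0 T, φ t • (u + v : L2Time T X) t =
      (∫ t in Ioo 0 T, φ t • u t) + ∫ t in Ioo 0 T, φ t • v t := by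
  rw [← integral_add (integrable_test_smul hφ u) (integrable_test_smul hφ v)]
  refine integral_congr_ae ?_
  filter_upwards [Lp.coeFn_add u v] with t ht
  rw [ht, Pi.add_apply, smul_add]

theorem integral_test_smul {T : ℝ} {X : Type} [NormedAddCommGroup X] [NormedSpace ℝ X]
    (φ : ℝ → ℝ) (c : ℝ) (u : L2Time T X) :
    ∫ t in Ioo 0 T, φ t • (c • u : L2Time T X) t = c • ∫ t in Ioo 0 T, φ t • u t := by
  rw [← integral_smul]
  refine integral_congr_ae ?_
  filter_upwards [Lp.coeFn_smul c u] with t ht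
  simp [ht, smul_comm c]

/-- The space `H^n(0,T;X)`. An element is the tuple `(u, ∂_t u, …, ∂_t^n u)` of a function in
`L²(0,T;X)` together with its weak time derivatives up to order `n`, all of them in `L²(0,T;X)`;
the norm is `(∑_{k ≤ n} ‖∂_t^k u‖²)^(1/2)`. -/
def sobolevTime (T : ℝ) (X : Type) [NormedAddCommGroup X] [NormedSpace ℝ X] [CompleteSpace X]
    (n : ℕ) : Submodule ℝ (PiLp 2 (fun _ : Fin (n + 1) => L2Time T X)) where
  carrier := {u | ∀ k : Fin (n + 1), IsWeakDerivTime (k : ℕ) (u 0) (u k)}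
  zero_mem' := by
    intro k φ hφ _ _
    have h (ψ : ℝ → ℝ) : ∫ t in Ioo 0 T, ψ t • (0 : L2Time T X) t = 0 := by
      simpa using integral_test_smul ψ 0 (0 : L2Time T X)
    simp only [PiLp.zero_apply, h, smul_zero]
  add_mem' := by
    intro u v hu hv k φ hφ hc hs
    have hk : Continuous (iteratedDeriv k φ) :=
      ContDiff.continuous_iteratedDeriv k hφ (by exact_mod_cast le_top)
    simp only [PiLp.add_apply, integral_test_add hk, integral_test_add hφ.continuous, smul_add]
    rw [hu k φ hφ hc hs, hv k φ hφ hc hs]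
  smul_mem' := by
    intro c u hu k φ hφ hc hs
    simp only [PiLp.smul_apply, integral_test_smul]
    rw [hu k φ hφ hc hs, smul_comm]

/-- `H^n(0,T;X)`, as a type. -/
abbrev HTime (T : ℝ) (X : Type) [NormedAddCommGroup X] [NormedSpace ℝ X] [CompleteSpace X]
    (n : ℕ) : Type := sobolevTime T X n

/-- The weak derivative `∂_t^k : H^n(0,T;X) → L²(0,T;X)`, for `k ≤ n`; for `k = 0` it is the
inclusion. -/
def dt {T : ℝ} {X : Type} [NormedAddCommGroup X] [NormedSpace ℝ X] [CompleteSpace X] {n : ℕ}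
    (k : Fin (n + 1)) : HTime T X n →L[ℝ] L2Time T X :=
  (PiLp.proj 2 (fun _ : Fin (n + 1) => L2Time T X) k).comp (sobolevTime T X n).subtypeL

/-- `u` has a representative that is continuous on `[0,T]` and takes the value `x` at time `0`. -/
def HasInitialValue {T : ℝ} {X : Type} [NormedAddCommGroup X] (u : L2Time T X) (x : X) : Prop :=
  ∃ w : ℝ → X, ContinuousOn w (Icc 0 T) ∧ u =ᵐ[volume.restrict (Ioo 0 T)] w ∧ w 0 = x

/-! ### The damped beam equation -/

/-- The inclusion `L²(0,T;H^m) ⊆ L²(0,T;L²)`. -/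
def inclL2 {P : ℝ} [Fact (0 < P)] {T : ℝ} {m : ℕ} :
    L2Time T (HTorus P m) →L[ℝ] L2Time T (L2Torus P) :=
  (dx (P := P) (m := m) 0).compLpL 2 (volume.restrict (Ioo 0 T))

/-- The space `L²(0,T;H⁴) ∩ H¹(0,T;H²) ∩ H²(0,T;L²)`, the intersection being taken inside
`L²(0,T;L²)`: its elements are the triples with one entry in each of the three spaces, such that
all entries are the same element of `L²(0,T;L²)`. -/
def beamSpace (P : ℝ) [Fact (0 < P)] (T : ℝ) :
    Submodule ℝ (L2Time T (HTorus P 4) × HTime T (HTorus P 2) 1 × HTime T (L2Torus P) 2) where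
  carrier := {u | inclL2 u.1 = dt 0 u.2.2 ∧ inclL2 (dt 0 u.2.1) = dt 0 u.2.2}
  zero_mem' := by simp
  add_mem' := by
    rintro u v ⟨h1, h2⟩ ⟨h3, h4⟩
    simp [h1, h2, h3, h4]
  smul_mem' := by
    rintro c u ⟨h1, h2⟩
    simp [h1, h2]

section Components

variable {P : ℝ} [Fact (0 < P)] {T : ℝ}

/-- `β` as an element of `L²(0,T;H⁴)`. -/
def inL2H4 (β : beamSpace P T) : L2Time T (HTorus P 4) := β.1.1

/-- `β` as an element of `H¹(0,T;H²)`. -/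
def inH1H2 (β : beamSpace P T) : HTime T (HTorus P 2) 1 := β.1.2.1

/-- `β` as an element of `H²(0,T;L²)`. -/
def inH2L2 (β : beamSpace P T) : HTime T (L2Torus P) 2 := β.1.2.2

/-- The norm of `(β, ∂_t β)` in `L²(0,T;H⁴×H²) ∩ H¹(0,T;H²×L²)`: the norms of `β` in `L²(0,T;H⁴)`,
of `∂_t β` in `L²(0,T;H²)`, of `β` in `H¹(0,T;H²)` and of `∂_t β` in `H¹(0,T;L²)`, added up. -/
def beamNorm (β : beamSpace P T) : ℝ :=
  ‖inL2H4 β‖ + ‖dt 1 (inH1H2 β)‖ + ‖inH1H2 β‖ +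
    Real.sqrt (‖dt 1 (inH2L2 β)‖ ^ 2 + ‖dt 2 (inH2L2 β)‖ ^ 2)

/-- `β` solves, in `L²(0,T;H⁴) ∩ H¹(0,T;H²) ∩ H²(0,T;L²)`, the damped beam equation
`∂_tt β - ∂_txx β + ∂_xxxx β + a β = v χ_W` almost everywhere on the torus times `(0,T)`,
with `β(·,0) = β₀` and `∂_t β(·,0) = β₁`. -/
structure IsBeamSolution (W : Set (AddCircle P)) (a : AddCircle P × ℝ → ℝ)
    (v : L2Time T (L2Torus P)) (β₀ : HTorus P 3) (β₁ : HTorus P 1)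
    (β : beamSpace P T) : Prop where
  equation : ∀ᵐ t ∂(volume.restrict (Ioo 0 T)), ∀ᵐ x ∂(volume : Measure (AddCircle P)),
    (dt 2 (inH2L2 β) t) x - (dx 2 (dt 1 (inH1H2 β) t)) x + (dx 4 (inL2H4 β t)) x
      + a (x, t) * (dx 0 (inL2H4 β t)) x = W.indicator (v t) x
  initial_displacement : HasInitialValue (dt 0 (inH2L2 β)) (dx 0 β₀)
  initial_velocity : HasInitialValue (dt 1 (inH2L2 β)) (dx 0 β₁)

end Components

instance fact_length_pos {d L : ℝ} [hd : Fact (0 < d)] [hL : Fact (0 < L)] :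
    Fact (0 < d + 2 * L) :=
  ⟨by linarith [hd.out, hL.out]⟩

/-- The control zone `ω = (-L,0) ∪ (d,d+L)`, as a subset of the torus `ℝ / (d+2L)ℤ`, which is
`(-L,d+L)` with periodic conditions. -/
def controlZone (d L : ℝ) : Set (AddCircle (d + 2 * L)) :=
  (fun y : ℝ => (y : AddCircle (d + 2 * L))) '' (Ioo (-L) 0 ∪ Ioo d (d + L))

end DampedBeam

end

open DampedBeam

/-!
The spatial operator is diagonal in the real orthonormal basis of Hartley functions
`(cos κx + sin κx) / √P`, `κ = 2πn/P`, `n ∈ ℤ`. With `μ = κ²`, the equation with a source `f` in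
place of `v χ_ω - a β` splits into the modes `y'' + μ y' + μ² y = f_n`. In these coordinates a weak
derivative on the torus is multiplication by wave numbers (`isWeakDerivTorus_iff`), so that the
Sobolev norms become weighted `ℓ²` norms (`isCoordSystem_HTorus`), and the du Bois-Reymond lemma
turns weak time derivatives and initial values into primitives
(`ae_eq_primitive_of_hasInitialValue`).

For a mode, the energy `μ (z² + μ² y²)`, `z = y'`, controls `∫ μ² z²` by `μ³ b₀² + μ b₁² + ∫ f²`,
and testing the equation with `μ² y` then controls `∫ μ⁴ y²`. This is maximal regularity with a
constant independent of `μ`, and the data enter exactly as in `H³ × H¹` (`IsMode.estimate`).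
Summation over the modes gives existence and estimates for the equation with a source
(`exists_isForcedSolution`, `IsForcedSolution.beamNorm_le`).

The potential is treated as a perturbation. In the norm of `L²(0,T;L²)` with the weight
`exp (-γ t)`, the solution operator of the equation with a source has norm at most `(γ - 2)^(-1/2)`
(`IsForcedSolution.weightedSq_le`), while multiplication by `a` is bounded by `M`. For
`γ = 4 M² + 3` the map that takes `u` to the solution with source `v χ_ω - a u` is therefore a
contraction, which yields existence, uniqueness and a bound of `β` in `L²(0,T;L²)` by the data;
maximal regularity upgrades this bound to the full norm.
-/

namespace DampedBeam

/-! ### Absolutely continuous functions -/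

/-- `p` is absolutely continuous on `[0,T]` with derivative `p'`: it is a primitive of the
integrable function `p'`. -/
structure IsPrimitive (T : ℝ) (p p' : ℝ → ℝ) : Prop where
  integrable : IntervalIntegrable p' volume 0 T
  eq_integral : ∀ t ∈ Icc 0 T, p t = p 0 + ∫ s in (0 : ℝ)..t, p' s

namespace IsPrimitive

variable {T : ℝ} {p p' q q' : ℝ → ℝ}

theorem integrable_Icc (h : IsPrimitive T p p') {t : ℝ} (ht : t ∈ Icc 0 T) :
    IntervalIntegrable p' volume 0 t :=
  h.integrable.mono_set (by
    rw [uIcc_of_le ht.1, uIcc_of_le (ht.1.trans ht.2)]; exact Icc_subset_Icc_right ht.2)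

theorem continuousOn (h : IsPrimitive T p p') (hT : 0 ≤ T) : ContinuousOn p (Icc 0 T) := by
  have : ContinuousOn (fun t => p 0 + ∫ s in (0 : ℝ)..t, p' s) (Icc 0 T) := by
    have := intervalIntegral.continuousOn_primitive_interval' h.integrable left_mem_uIcc
    rw [uIcc_of_le hT] at this
    exact continuousOn_const.add this
  exact this.congr h.eq_integral

theorem add (h : IsPrimitive T p p') (k : IsPrimitive T q q') :
    IsPrimitive T (fun t => p t + q t) (fun t => p' t + q' t) where
  integrable := h.integrable.add k.integrable
  eq_integral t ht := by
    rw [intervalIntegral.integral_add (h.integrable_Icc ht) (k.integrable_Icc ht),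
      h.eq_integral t ht, k.eq_integral t ht]
    ring

theorem const_mul (c : ℝ) (h : IsPrimitive T p p') :
    IsPrimitive T (fun t => c * p t) (fun t => c * p' t) where
  integrable := h.integrable.const_mul c
  eq_integral t ht := by
    rw [intervalIntegral.integral_const_mul, h.eq_integral t ht]
    ring

theorem of_hasDerivAt (hp : ∀ t, HasDerivAt p (p' t) t) (hc : Continuous p') :
    IsPrimitive T p p' where
  integrable := hc.intervalIntegrable _ _
  eq_integral t _ := by
    rw [intervalIntegral.integral_eq_sub_of_hasDerivAt (fun s _ => hp s)
      (hc.intervalIntegrable _ _)]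
    ring

theorem mul (hT : 0 ≤ T) (h : IsPrimitive T p p') (k : IsPrimitive T q q') :
    IsPrimitive T (fun t => p t * q t) (fun t => p' t * q t + p t * q' t) := by
  have hp := h.continuousOn hT
  have hq := k.continuousOn hT
  have hi : IntervalIntegrable (fun t => p' t * q t + p t * q' t) volume 0 T := by
    refine (h.integrable.mul_continuousOn ?_).add (k.integrable.continuousOn_mul ?_)
    all_goals rwa [uIcc_of_le hT]
  refine ⟨hi, fun t ht => ?_⟩
  have hle := ht.1
  set P : ℝ → ℝ := fun x => p 0 + ∫ s in (0 : ℝ)..x, p' s with hP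
  set Q : ℝ → ℝ := fun x => q 0 + ∫ s in (0 : ℝ)..x, q' s with hQ
  have ac (r : ℝ → ℝ) (c : ℝ) (hr : IntervalIntegrable r volume 0 t) :
      AbsolutelyContinuousOnInterval (fun x => c + ∫ s in (0 : ℝ)..x, r s) 0 t :=
    (LipschitzWith.const c).lipschitzOnWith.absolutelyContinuousOnInterval.add
      (hr.absolutelyContinuousOnInterval_intervalIntegral left_mem_uIcc)
  have hd (r : ℝ → ℝ) (c : ℝ) (hr : IntervalIntegrable r volume 0 t) :
      ∀ᵐ x, x ∈ uIcc 0 t → HasDerivAt (fun x => c + ∫ s in (0 : ℝ)..x, r s) (r x) x := by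
    filter_upwards [hr.ae_hasDerivAt_integral] with x hx hx'
    exact (hx hx' 0 left_mem_uIcc).const_add c
  have key := AbsolutelyContinuousOnInterval.integral_deriv_mul_eq_sub
    (ac p' (p 0) (h.integrable_Icc ht)) (ac q' (q 0) (k.integrable_Icc ht))
  have hcongr : ∫ x in (0 : ℝ)..t, (deriv P x * Q x + P x * deriv Q x) =
      ∫ x in (0 : ℝ)..t, (p' x * q x + p x * q' x) := by
    refine intervalIntegral.integral_congr_ae ?_
    filter_upwards [hd p' (p 0) (h.integrable_Icc ht), hd q' (q 0) (k.integrable_Icc ht)]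
      with x h1 h2 hx
    have hx1 : x ∈ uIcc 0 t := uIoc_subset_uIcc hx
    have hx2 : x ∈ Icc 0 T := by
      rw [uIcc_of_le hle] at hx1; exact ⟨hx1.1, hx1.2.trans ht.2⟩
    rw [(h1 hx1).deriv, (h2 hx1).deriv]
    simp only [hP, hQ, ← h.eq_integral x hx2, ← k.eq_integral x hx2]
  have e1 : P t = p t := (h.eq_integral t ht).symm
  have e2 : Q t = q t := (k.eq_integral t ht).symm
  have e3 : P 0 = p 0 := by simp [hP]
  have e4 : Q 0 = q 0 := by simp [hQ]
  have : ∫ x in (0 : ℝ)..t, (p' x * q x + p x * q' x) = P t * Q t - P 0 * Q 0 := by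
    rw [← hcongr]; exact key
  rw [this, e1, e2, e3, e4]; ring

/-- The fundamental theorem of calculus on the whole interval, as an integral over `(0,T)`. -/
theorem integral_eq_sub (hT : 0 ≤ T) (h : IsPrimitive T p p') :
    ∫ t in Ioo 0 T, p' t = p T - p 0 := by
  rw [h.eq_integral T ⟨hT, le_rfl⟩, intervalIntegral.integral_of_le hT,
    integral_Ioc_eq_integral_Ioo]
  ring

theorem integrableOn (hT : 0 ≤ T) (h : IsPrimitive T p p') :
    Integrable p' (volume.restrict (Ioo 0 T)) := by
  have := h.integrable
  rwa [intervalIntegrable_iff_integrableOn_Ioo_of_le hT] at this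

theorem congr_deriv {p'' : ℝ → ℝ} (hT : 0 ≤ T) (h : IsPrimitive T p p')
    (hc : p' =ᵐ[volume.restrict (Ioo 0 T)] p'') : IsPrimitive T p p'' where
  integrable := by
    rw [intervalIntegrable_iff_integrableOn_Ioo_of_le hT]
    exact (h.integrableOn hT).congr hc
  eq_integral t ht := by
    rw [h.eq_integral t ht]
    congr 1
    refine intervalIntegral.integral_congr_ae ?_
    have hc' : p' =ᵐ[volume.restrict (Ioc 0 T)] p'' := by
      rwa [← restrict_Ioo_eq_restrict_Ioc]
    rw [Filter.EventuallyEq, ae_restrict_iff' measurableSet_Ioc] at hc'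
    filter_upwards [hc'] with x hx hx'
    rw [uIoc_of_le ht.1] at hx'
    exact hx ⟨hx'.1, hx'.2.trans ht.2⟩

theorem of_integrableOn (hT : 0 ≤ T) (c : ℝ) {g : ℝ → ℝ}
    (hg : Integrable g (volume.restrict (Ioo 0 T))) :
    IsPrimitive T (fun t => c + ∫ s in (0 : ℝ)..t, g s) g where
  integrable := by
    rw [intervalIntegrable_iff_integrableOn_Ioo_of_le hT]; exact hg
  eq_integral t _ := by simp

/-- Monotonicity of the fundamental theorem of calculus: an a.e. bound on the derivative bounds
the increment. -/
theorem sub_le_integral (hT : 0 ≤ T) (h : IsPrimitive T p p') {g : ℝ → ℝ}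
    (hg : Integrable g (volume.restrict (Ioo 0 T)))
    (hle : ∀ᵐ t ∂(volume.restrict (Ioo 0 T)), p' t ≤ g t) :
    p T - p 0 ≤ ∫ t in Ioo 0 T, g t := by
  rw [← h.integral_eq_sub hT]
  exact integral_mono_ae (h.integrableOn hT) hg hle

end IsPrimitive

/-! ### Weak derivatives in time -/

theorem integral_deriv_mul_of_isPrimitive {T : ℝ} (hT : 0 < T) {u v : ℝ → ℝ}
    (h : IsPrimitive T u v) {φ : ℝ → ℝ} (hφ : ContDiff ℝ ∞ φ) (hs : tsupport φ ⊆ Ioo 0 T) :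
    ∫ t in Ioo 0 T, deriv φ t * u t = -∫ t in Ioo 0 T, φ t * v t := by
  have hz (x : ℝ) (hx : x ∉ Ioo 0 T) : φ x = 0 :=
    image_eq_zero_of_notMem_tsupport fun h => hx (hs h)
  have hφ' : Continuous (deriv φ) := hφ.continuous_deriv (by exact_mod_cast le_top)
  have hd : IsPrimitive T φ (deriv φ) :=
    IsPrimitive.of_hasDerivAt
      (fun t => ((hφ.differentiable (by simp)) t).hasDerivAt) hφ'
  have key := (hd.mul hT.le h).integral_eq_sub hT.le
  rw [hz 0 (by simp), hz T (by simp)] at key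
  have i1 : Integrable (fun t => deriv φ t * u t) (volume.restrict (Ioo 0 T)) := by
    have : IntervalIntegrable (fun t => deriv φ t * u t) volume 0 T := by
      refine ContinuousOn.intervalIntegrable ?_
      rw [uIcc_of_le hT.le]
      exact hφ'.continuousOn.mul (h.continuousOn hT.le)
    rwa [intervalIntegrable_iff_integrableOn_Ioo_of_le hT.le] at this
  have i2 : Integrable (fun t => φ t * v t) (volume.restrict (Ioo 0 T)) := by
    have : IntervalIntegrable (fun t => φ t * v t) volume 0 T :=
      h.integrable.continuousOn_mul hφ.continuous.continuousOn
    rwa [intervalIntegrable_iff_integrableOn_Ioo_of_le hT.le] at this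
  rw [integral_add i1 i2] at key
  linarith

theorem exists_Icc_of_tsupport_subset {T : ℝ} (hT : 0 < T) {K : Set ℝ} (hK : IsCompact K)
    (hs : K ⊆ Ioo 0 T) : ∃ a b, 0 < a ∧ a ≤ b ∧ b < T ∧ K ⊆ Icc a b := by
  rcases K.eq_empty_or_nonempty with rfl | hne
  · exact ⟨T / 2, T / 2, by linarith, le_rfl, by linarith, empty_subset _⟩
  · refine ⟨sInf K, sSup K, (hs (hK.sInf_mem hne)).1, ?_, (hs (hK.sSup_mem hne)).2,
      fun x hx => ⟨csInf_le hK.bddBelow hx, le_csSup hK.bddAbove hx⟩⟩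
    exact csInf_le_csSup hne hK.bddBelow hK.bddAbove

/-- The **du Bois-Reymond lemma**, for constants. A test function `ψ` is, up to a multiple of a
fixed test function `η` of integral one, the derivative of a test function. -/
theorem ae_eq_const_of_integral_deriv_mul_eq_zero {T : ℝ} (hT : 0 < T) {h : ℝ → ℝ}
    (hi : Integrable h (volume.restrict (Ioo 0 T)))
    (hz : ∀ φ : ℝ → ℝ, ContDiff ℝ ∞ φ → HasCompactSupport φ → tsupport φ ⊆ Ioo 0 T →
      ∫ t in Ioo 0 T, deriv φ t * h t = 0) :
    ∃ c : ℝ, ∀ᵐ t ∂(volume.restrict (Ioo 0 T)), h t = c := by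
  have mulint (g : ℝ → ℝ) (hg : Continuous g) :
      Integrable (fun t => g t * h t) (volume.restrict (Ioo 0 T)) := by
    obtain ⟨C, hC⟩ := (isCompact_Icc (a := (0 : ℝ)) (b := T)).exists_bound_of_continuousOn
      hg.continuousOn
    refine hi.bdd_mul (c := C) hg.aestronglyMeasurable ?_
    filter_upwards [ae_restrict_mem measurableSet_Ioo] with t ht
    exact hC t (Ioo_subset_Icc_self ht)
  let B : ContDiffBump (T / 2) := ⟨T / 8, T / 4, by linarith, by linarith⟩
  set η : ℝ → ℝ := B.normed volume with hη
  have hη1 : ContDiff ℝ ∞ η := B.contDiff_normed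
  have hη2 : HasCompactSupport η := B.hasCompactSupport_normed
  have hη3 : tsupport η ⊆ Ioo 0 T := by
    rw [hη, B.tsupport_normed_eq, Real.closedBall_eq_Icc]
    intro x hx
    simp only [mem_Icc, mem_Ioo, B] at hx ⊢
    constructor <;> linarith [hx.1, hx.2]
  have hη4 : ∫ t, η t = 1 := B.integral_normed
  refine ⟨∫ t in Ioo 0 T, η t * h t, ?_⟩
  set c := ∫ t in Ioo 0 T, η t * h t with hc
  have hfin : IsFiniteMeasure (volume.restrict (Ioo 0 T)) := inferInstance
  have hloc : LocallyIntegrableOn (fun t => h t - c) (Ioo 0 T) volume := by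
    have : IntegrableOn (fun t => h t - c) (Ioo 0 T) volume := hi.sub (integrable_const c)
    exact this.locallyIntegrableOn
  have main := isOpen_Ioo.ae_eq_zero_of_integral_contDiff_smul_eq_zero hloc ?_
  · rw [ae_restrict_iff' measurableSet_Ioo]
    filter_upwards [main] with t ht ht'
    linarith [ht ht']
  intro ψ hψ1 hψ2 hψ3
  set m := ∫ t, ψ t with hm
  set g : ℝ → ℝ := fun t => ψ t - m * η t with hg
  have hgc : Continuous g := hψ1.continuous.sub (continuous_const.mul hη1.continuous)
  have hgs : ContDiff ℝ ∞ g := hψ1.sub (contDiff_const.mul hη1)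
  obtain ⟨a, b, ha, hab, hb, hK⟩ := exists_Icc_of_tsupport_subset hT (hψ2.union hη2)
    (union_subset hψ3 hη3)
  have hg0 (x : ℝ) (hx : x ∉ Icc a b) : g x = 0 := by
    have h1 : ψ x = 0 := image_eq_zero_of_notMem_tsupport fun h => hx (hK (Or.inl h))
    have h2 : η x = 0 := image_eq_zero_of_notMem_tsupport fun h => hx (hK (Or.inr h))
    simp [hg, h1, h2]
  have hsupp : Function.support g ⊆ Ioc 0 T := fun x hx => by
    by_contra hx'
    exact hx (hg0 x fun hx2 => hx' ⟨ha.trans_le hx2.1, (hx2.2.trans_lt hb).le⟩)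
  have hgint : ∫ t, g t = 0 := by
    rw [hg, integral_sub (hψ1.continuous.integrable_of_hasCompactSupport hψ2)
      ((hη1.continuous.integrable_of_hasCompactSupport hη2).const_mul m), integral_const_mul, hη4]
    simp [hm]
  set φ : ℝ → ℝ := fun t => ∫ s in (0 : ℝ)..t, g s with hφ
  have hφd (t : ℝ) : HasDerivAt φ (g t) t :=
    intervalIntegral.integral_hasDerivAt_right (hgc.intervalIntegrable _ _)
      hgc.stronglyMeasurable.stronglyMeasurableAtFilter hgc.continuousAt
  have hdφ : deriv φ = g := funext fun t => (hφd t).deriv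
  have hφs : ContDiff ℝ ∞ φ := by
    rw [contDiff_infty_iff_deriv]
    exact ⟨fun t => (hφd t).differentiableAt, by rwa [hdφ]⟩
  have hφ0 (x : ℝ) (hx : x ∉ Icc a b) : φ x = 0 := by
    rcases lt_or_ge x a with hxa | hxa
    · refine intervalIntegral.integral_zero_ae (Filter.Eventually.of_forall fun s hs => ?_)
      refine hg0 s fun h => ?_
      have : s ≤ max 0 x := hs.2
      rcases max_le_iff.1 (le_refl (max 0 x)) with ⟨_, _⟩
      have : max 0 x < a := max_lt ha hxa
      linarith [h.1]
    · have hbx : b < x := by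
        by_contra hcon
        exact hx ⟨hxa, not_lt.1 hcon⟩
      have hs' : Function.support g ⊆ Ioc 0 x := fun y hy => by
        by_contra hy'
        exact hy (hg0 y fun hx2 => hy' ⟨ha.trans_le hx2.1, (hx2.2.trans hbx.le)⟩)
      simp only [hφ]
      rw [intervalIntegral.integral_eq_integral_of_support_subset hs', hgint]
  have hφt : tsupport φ ⊆ Icc a b :=
    closure_minimal (fun x hx => by by_contra h; exact hx (hφ0 x h)) isClosed_Icc
  have hφc : HasCompactSupport φ := HasCompactSupport.of_support_subset_isCompact isCompact_Icc
    (subset_closure.trans hφt)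
  have key := hz φ hφs hφc (hφt.trans fun x hx => ⟨ha.trans_le hx.1, hx.2.trans_lt hb⟩)
  rw [hdφ] at key
  have hmI : ∫ t in Ioo 0 T, ψ t = m :=
    setIntegral_eq_integral_of_forall_compl_eq_zero fun x hx =>
      image_eq_zero_of_notMem_tsupport fun h => hx (hψ3 h)
  have e1 : ∫ t in Ioo 0 T, g t * h t = (∫ t in Ioo 0 T, ψ t * h t) - m * c := by
    rw [hc, ← integral_const_mul, ← integral_sub (mulint ψ hψ1.continuous)
      ((mulint η hη1.continuous).const_mul m)]
    refine integral_congr_ae (Filter.Eventually.of_forall fun t => ?_)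
    simp only [hg]; ring
  have e2 : ∫ t in Ioo 0 T, ψ t • (h t - c) = (∫ t in Ioo 0 T, ψ t * h t) - m * c := by
    rw [← hmI, ← integral_mul_const, ← integral_sub (mulint ψ hψ1.continuous)
      (((hψ1.continuous.integrable_of_hasCompactSupport hψ2).integrableOn).mul_const c)]
    refine integral_congr_ae (Filter.Eventually.of_forall fun t => ?_)
    simp only [smul_eq_mul]; ring
  have e3 : ∫ t, ψ t • (h t - c) = ∫ t in Ioo 0 T, ψ t • (h t - c) :=
    (setIntegral_eq_integral_of_forall_compl_eq_zero fun x hx => by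
      rw [image_eq_zero_of_notMem_tsupport fun h => hx (hψ3 h), zero_smul]).symm
  rw [e3, e2, ← e1, key]

/-- A function with an integrable weak derivative `v` on `(0,T)` whose continuous representative
starts from `b` is the primitive of `v` starting from `b`. -/
theorem ae_eq_primitive_of_weakDeriv {T : ℝ} (hT : 0 < T) {u v w : ℝ → ℝ}
    (hu : Integrable u (volume.restrict (Ioo 0 T)))
    (hv : Integrable v (volume.restrict (Ioo 0 T)))
    (hd : ∀ φ : ℝ → ℝ, ContDiff ℝ ∞ φ → HasCompactSupport φ → tsupport φ ⊆ Ioo 0 T →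
      ∫ t in Ioo 0 T, deriv φ t * u t = -∫ t in Ioo 0 T, φ t * v t)
    (hw : ContinuousOn w (Icc 0 T)) (huw : u =ᵐ[volume.restrict (Ioo 0 T)] w) :
    u =ᵐ[volume.restrict (Ioo 0 T)] fun t => w 0 + ∫ s in (0 : ℝ)..t, v s := by
  have hV := IsPrimitive.of_integrableOn hT.le 0 hv
  set V : ℝ → ℝ := fun t => 0 + ∫ s in (0 : ℝ)..t, v s with hVdef
  have hVc : ContinuousOn V (Icc 0 T) := hV.continuousOn hT.le
  have hVi : Integrable V (volume.restrict (Ioo 0 T)) :=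
    (hVc.integrableOn_Icc (μ := volume)).mono_set Ioo_subset_Icc_self
  obtain ⟨c, hc⟩ := ae_eq_const_of_integral_deriv_mul_eq_zero hT (hu.sub hVi) fun φ h1 h2 h3 => by
    have hφ' : Continuous (deriv φ) := h1.continuous_deriv (by exact_mod_cast le_top)
    obtain ⟨C, hC⟩ := (isCompact_Icc (a := (0 : ℝ)) (b := T)).exists_bound_of_continuousOn
      hφ'.continuousOn
    have hb : ∀ᵐ t ∂(volume.restrict (Ioo 0 T)), ‖deriv φ t‖ ≤ C := by
      filter_upwards [ae_restrict_mem measurableSet_Ioo] with t ht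
      exact hC t (Ioo_subset_Icc_self ht)
    have e := integral_sub (hu.bdd_mul (c := C) hφ'.aestronglyMeasurable hb)
      (hVi.bdd_mul (c := C) hφ'.aestronglyMeasurable hb)
    rw [hd φ h1 h2 h3, integral_deriv_mul_of_isPrimitive hT hV h1 h3] at e
    simp only [Pi.sub_apply, mul_sub]
    rw [e, sub_self]
  have hwV : w =ᵐ[volume.restrict (Icc 0 T)] fun t => c + V t := by
    rw [← restrict_Ioo_eq_restrict_Icc]
    filter_upwards [hc, huw] with t h1 h2
    simp only [Pi.sub_apply] at h1
    linarith
  have hEq := Measure.eqOn_Icc_of_ae_eq volume hT.ne hwV hw (continuousOn_const.add hVc)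
  have h0 : w 0 = c := by
    rw [hEq ⟨le_rfl, hT.le⟩]; simp [hVdef]
  filter_upwards [huw, ae_restrict_mem measurableSet_Ioo] with t h1 h2
  rw [h1, hEq (Ioo_subset_Icc_self h2), h0]
  simp [hVdef]

/-! ### Energy estimates for a single mode -/

theorem integrable_of_continuousOn {T : ℝ} {g : ℝ → ℝ} (hg : ContinuousOn g (Icc 0 T)) :
    Integrable g (volume.restrict (Ioo 0 T)) :=
  (hg.integrableOn_Icc (μ := volume)).mono_set Ioo_subset_Icc_self

theorem continuous_weight (γ : ℝ) : Continuous fun t : ℝ => Real.exp (-γ * t) := by fun_prop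

theorem weight_le_one {γ T : ℝ} (hγ : 0 ≤ γ) {t : ℝ} (ht : t ∈ Ioo 0 T) :
    Real.exp (-γ * t) ≤ 1 :=
  Real.exp_le_one_iff.2 (by nlinarith [ht.1])

theorem integrable_weight_mul {T : ℝ} (γ : ℝ) {g : ℝ → ℝ}
    (hg : Integrable g (volume.restrict (Ioo 0 T))) :
    Integrable (fun t => Real.exp (-γ * t) * g t) (volume.restrict (Ioo 0 T)) := by
  obtain ⟨C, hC⟩ := (isCompact_Icc (a := (0 : ℝ)) (b := T)).exists_bound_of_continuousOn
    (continuous_weight γ).continuousOn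
  refine hg.bdd_mul (c := C) (continuous_weight γ).aestronglyMeasurable ?_
  filter_upwards [ae_restrict_mem measurableSet_Ioo] with t ht
  exact hC t (Ioo_subset_Icc_self ht)

/-- Adding an exponential weight does not decrease an integral by more than the factor
`exp (-γ T)`. -/
theorem integral_le_exp_mul_weighted {T γ : ℝ} (hγ : 0 ≤ γ) {g : ℝ → ℝ}
    (hg : Integrable g (volume.restrict (Ioo 0 T))) (h0 : ∀ t, 0 ≤ g t) :
    ∫ t in Ioo 0 T, g t ≤ Real.exp (γ * T) * ∫ t in Ioo 0 T, Real.exp (-γ * t) * g t := by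
  rw [← integral_const_mul]
  refine integral_mono_ae hg ((integrable_weight_mul γ hg).const_mul _) ?_
  filter_upwards [ae_restrict_mem measurableSet_Ioo] with t ht
  rw [← mul_assoc, ← Real.exp_add]
  refine le_mul_of_one_le_left (h0 t) (Real.one_le_exp ?_)
  nlinarith [ht.2]

theorem weighted_le_integral {T γ : ℝ} (hγ : 0 ≤ γ) {g : ℝ → ℝ}
    (hg : Integrable g (volume.restrict (Ioo 0 T))) (h0 : ∀ t, 0 ≤ g t) :
    ∫ t in Ioo 0 T, Real.exp (-γ * t) * g t ≤ ∫ t in Ioo 0 T, g t := by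
  refine integral_mono_ae (integrable_weight_mul γ hg) hg ?_
  filter_upwards [ae_restrict_mem measurableSet_Ioo] with t ht
  exact mul_le_of_le_one_left (h0 t) (weight_le_one hγ ht)

theorem IsPrimitive.weight_mul {T : ℝ} (hT : 0 ≤ T) (γ : ℝ) {p p' : ℝ → ℝ}
    (h : IsPrimitive T p p') :
    IsPrimitive T (fun t => Real.exp (-γ * t) * p t)
      (fun t => -γ * Real.exp (-γ * t) * p t + Real.exp (-γ * t) * p' t) := by
  refine IsPrimitive.mul hT (IsPrimitive.of_hasDerivAt (fun t => ?_) (by fun_prop)) h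
  have := ((hasDerivAt_id t).const_mul (-γ)).exp
  simp only [id, mul_one] at this
  convert this using 1
  ring

/-- In the weighted norm, integration from zero is as small as the weight is strong. -/
theorem IsPrimitive.weighted_sq_le {T γ : ℝ} (hT : 0 ≤ T) (hγ : 0 < γ) {z w : ℝ → ℝ}
    (h : IsPrimitive T z w) (h0 : z 0 = 0)
    (hw : Integrable (fun t => w t ^ 2) (volume.restrict (Ioo 0 T))) :
    ∫ t in Ioo 0 T, Real.exp (-γ * t) * z t ^ 2 ≤
      4 / γ ^ 2 * ∫ t in Ioo 0 T, Real.exp (-γ * t) * w t ^ 2 := by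
  have hz := h.continuousOn hT
  have iz : Integrable (fun t => Real.exp (-γ * t) * z t ^ 2) (volume.restrict (Ioo 0 T)) :=
    integrable_weight_mul γ (integrable_of_continuousOn (hz.pow 2))
  have iw := integrable_weight_mul γ hw
  have key := ((h.mul hT h).weight_mul hT γ).sub_le_integral hT
    (g := fun t => 2 / γ * (Real.exp (-γ * t) * w t ^ 2) - γ / 2 * (Real.exp (-γ * t) * z t ^ 2))
    ((iw.const_mul _).sub (iz.const_mul _)) (Filter.Eventually.of_forall fun t => by
      have e : (2 / γ * (Real.exp (-γ * t) * w t ^ 2) - γ / 2 * (Real.exp (-γ * t) * z t ^ 2)) -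
        (-γ * Real.exp (-γ * t) * (z t * z t) +
          Real.exp (-γ * t) * (w t * z t + z t * w t)) =
          Real.exp (-γ * t) * (2 / γ) * (w t - γ / 2 * z t) ^ 2 := by
        field_simp; ring
      have : 0 ≤ Real.exp (-γ * t) * (2 / γ) * (w t - γ / 2 * z t) ^ 2 := by positivity
      linarith)
  rw [integral_sub (iw.const_mul _) (iz.const_mul _), integral_const_mul, integral_const_mul, h0]
    at key
  have : 0 ≤ Real.exp (-γ * T) * (z T * z T) :=
    mul_nonneg (Real.exp_pos _).le (mul_self_nonneg _)
  have h2 : γ / 2 * ∫ t in Ioo 0 T, Real.exp (-γ * t) * z t ^ 2 ≤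
      2 / γ * ∫ t in Ioo 0 T, Real.exp (-γ * t) * w t ^ 2 := by linarith
  have h3 := mul_le_mul_of_nonneg_left h2 (show 0 ≤ 2 / γ by positivity)
  calc _ = 2 / γ * (γ / 2 * ∫ t in Ioo 0 T, Real.exp (-γ * t) * z t ^ 2) := by field_simp
    _ ≤ _ := h3
    _ = _ := by field_simp; ring

/-- The equation of a mode of frequency `μ`, i.e. `y'' + μ y' + μ² y = f` with `y(0) = b₀` and
`y'(0) = b₁`, for absolutely continuous `y` and `z = y'`, where `w = y''`. -/
structure IsMode (T μ b₀ b₁ : ℝ) (f y z w : ℝ → ℝ) : Prop where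
  primitive : IsPrimitive T y z
  primitive' : IsPrimitive T z w
  init : y 0 = b₀
  init' : z 0 = b₁
  memLp : MemLp f 2 (volume.restrict (Ioo 0 T))
  equation : ∀ᵐ t ∂(volume.restrict (Ioo 0 T)), w t + μ * z t + μ ^ 2 * y t = f t

namespace IsMode

variable {T μ b₀ b₁ : ℝ} {f y z w : ℝ → ℝ}

theorem continuousOn (h : IsMode T μ b₀ b₁ f y z w) (hT : 0 ≤ T) :
    ContinuousOn y (Icc 0 T) ∧ ContinuousOn z (Icc 0 T) :=
  ⟨h.primitive.continuousOn hT, h.primitive'.continuousOn hT⟩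

/-- The weighted energy estimate: `E = z² + (1 + μ²) y²` satisfies `E' ≤ f² + 2 E`. -/
theorem weighted_energy (h : IsMode T μ b₀ b₁ f y z w) (hT : 0 ≤ T) (hμ : 0 ≤ μ) {γ : ℝ}
    (hγ : 2 ≤ γ) :
    (γ - 2) * ∫ t in Ioo 0 T, Real.exp (-γ * t) * (y t ^ 2 + z t ^ 2) ≤
      (1 + μ ^ 2) * b₀ ^ 2 + b₁ ^ 2 + ∫ t in Ioo 0 T, Real.exp (-γ * t) * f t ^ 2 := by
  obtain ⟨hy, hz⟩ := h.continuousOn hT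
  have if2 := integrable_weight_mul γ h.memLp.integrable_sq
  have iyz : Integrable (fun t => Real.exp (-γ * t) * (y t ^ 2 + z t ^ 2))
      (volume.restrict (Ioo 0 T)) :=
    integrable_weight_mul γ (integrable_of_continuousOn ((hy.pow 2).add (hz.pow 2)))
  have hE := (h.primitive'.mul hT h.primitive').add
    ((h.primitive.mul hT h.primitive).const_mul (1 + μ ^ 2))
  have key := (hE.weight_mul hT γ).sub_le_integral hT
    (g := fun t => Real.exp (-γ * t) * f t ^ 2 -
      (γ - 2) * (Real.exp (-γ * t) * (y t ^ 2 + z t ^ 2))) (if2.sub (iyz.const_mul _)) (by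
    filter_upwards [h.equation] with t ht
    have hw : w t = f t - μ * z t - μ ^ 2 * y t := by linarith
    -- The bound exceeds the derivative by a sum of nonnegative terms.
    have e : (Real.exp (-γ * t) * f t ^ 2 -
        (γ - 2) * (Real.exp (-γ * t) * (y t ^ 2 + z t ^ 2))) -
        (-γ * Real.exp (-γ * t) * (z t * z t + (1 + μ ^ 2) * (y t * y t)) +
          Real.exp (-γ * t) * (w t * z t + z t * w t +
            (1 + μ ^ 2) * (z t * y t + y t * z t))) =
        Real.exp (-γ * t) * ((f t - z t) ^ 2 + (z t - y t) ^ 2 + 2 * μ * z t ^ 2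
          + y t ^ 2 + γ * (μ ^ 2 * y t ^ 2)) := by
      rw [hw]; ring
    have : 0 ≤ Real.exp (-γ * t) * ((f t - z t) ^ 2 + (z t - y t) ^ 2 + 2 * μ * z t ^ 2
          + y t ^ 2 + γ * (μ ^ 2 * y t ^ 2)) := by
      have : 0 ≤ γ := by linarith
      positivity
    linarith)
  rw [integral_sub if2 (iyz.const_mul _), integral_const_mul, h.init, h.init'] at key
  have : 0 ≤ Real.exp (-γ * T) * (z T * z T + (1 + μ ^ 2) * (y T * y T)) :=
    mul_nonneg (Real.exp_pos _).le (add_nonneg (mul_self_nonneg _)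
      (mul_nonneg (by positivity) (mul_self_nonneg _)))
  simp only [mul_zero, Real.exp_zero, one_mul] at key
  linarith

/-- Maximal regularity of a mode: the higher-order energy `F = μ (z² + μ² y²)`, which is at the
level of `H³ × H¹` data, controls `μ z`; testing with `μ² y` then controls `μ² y`. -/
theorem maximal_regularity (h : IsMode T μ b₀ b₁ f y z w) (hT : 0 ≤ T) (hμ : 0 ≤ μ) :
    ∫ t in Ioo 0 T, μ ^ 2 * z t ^ 2 ≤
        μ ^ 3 * b₀ ^ 2 + μ * b₁ ^ 2 + ∫ t in Ioo 0 T, f t ^ 2 ∧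
      ∫ t in Ioo 0 T, μ ^ 4 * y t ^ 2 ≤
        5 * (μ ^ 3 * b₀ ^ 2 + μ * b₁ ^ 2 + ∫ t in Ioo 0 T, f t ^ 2) := by
  obtain ⟨hy, hz⟩ := h.continuousOn hT
  have if2 := h.memLp.integrable_sq
  have iy : Integrable (fun t => μ ^ 4 * y t ^ 2) (volume.restrict (Ioo 0 T)) :=
    (integrable_of_continuousOn (hy.pow 2)).const_mul _
  have iz : Integrable (fun t => μ ^ 2 * z t ^ 2) (volume.restrict (Ioo 0 T)) :=
    (integrable_of_continuousOn (hz.pow 2)).const_mul _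
  have hF := (h.primitive'.mul hT h.primitive').const_mul μ |>.add
    ((h.primitive.mul hT h.primitive).const_mul (μ ^ 3))
  have kF := hF.sub_le_integral hT
    (g := fun t => f t ^ 2 - μ ^ 2 * z t ^ 2) (if2.sub iz) (by
    filter_upwards [h.equation] with t ht
    have hw : w t = f t - μ * z t - μ ^ 2 * y t := by linarith
    have e : (f t ^ 2 - μ ^ 2 * z t ^ 2) - (μ * (w t * z t + z t * w t) +
        μ ^ 3 * (z t * y t + y t * z t)) = (f t - μ * z t) ^ 2 := by
      rw [hw]; ring
    linarith [sq_nonneg (f t - μ * z t)])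
  rw [integral_sub if2 iz, h.init, h.init'] at kF
  -- `G = 2 μ² y z + μ³ y²`, with `F + G = μ (z + μ y)² + μ³ y²`.
  have hG := ((h.primitive.mul hT h.primitive').const_mul (2 * μ ^ 2)).add
    ((h.primitive.mul hT h.primitive).const_mul (μ ^ 3))
  have kG := hG.sub_le_integral hT
    (g := fun t => 2 * (μ ^ 2 * z t ^ 2) + f t ^ 2 - μ ^ 4 * y t ^ 2)
    (((iz.const_mul 2).add if2).sub iy) (by
    filter_upwards [h.equation] with t ht
    have hw : w t = f t - μ * z t - μ ^ 2 * y t := by linarith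
    have e : (2 * (μ ^ 2 * z t ^ 2) + f t ^ 2 - μ ^ 4 * y t ^ 2) -
        (2 * μ ^ 2 * (z t * z t + y t * w t) + μ ^ 3 * (z t * y t + y t * z t)) =
        (f t - μ ^ 2 * y t) ^ 2 := by
      rw [hw]; ring
    linarith [sq_nonneg (f t - μ ^ 2 * y t)])
  have i2 : Integrable (fun t => 2 * (μ ^ 2 * z t ^ 2) + f t ^ 2) (volume.restrict (Ioo 0 T)) :=
    (iz.const_mul 2).add if2
  rw [integral_sub i2 iy, integral_add (iz.const_mul 2) if2, integral_const_mul 2, h.init, h.init'] at kG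
  have p1 : 0 ≤ μ * (z T * z T) := mul_nonneg hμ (mul_self_nonneg _)
  have p2 : 0 ≤ μ ^ 3 * (y T * y T) := mul_nonneg (by positivity) (mul_self_nonneg _)
  have p3 : 0 ≤ μ * (z T + μ * y T) ^ 2 := by positivity
  have p4 : 0 ≤ μ * (b₁ - μ * b₀) ^ 2 := by positivity
  have p5 : 0 ≤ ∫ t in Ioo 0 T, f t ^ 2 := integral_nonneg fun t => sq_nonneg _
  have p6 : 0 ≤ ∫ t in Ioo 0 T, μ ^ 2 * z t ^ 2 := integral_nonneg fun t => by positivity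
  have p7 : 0 ≤ μ * b₁ ^ 2 := by positivity
  have p8 : 0 ≤ μ ^ 3 * b₀ ^ 2 := by positivity
  constructor
  · linarith
  · nlinarith

end IsMode

/-- The weight `1 + μ + ⋯ + μ^m` of a mode of frequency `μ` in the norm of `H^m`. -/
def sobolevWeight (m : ℕ) (μ : ℝ) : ℝ := ∑ k ∈ Finset.range (m + 1), μ ^ k

theorem one_le_sobolevWeight (m : ℕ) {μ : ℝ} (hμ : 0 ≤ μ) : 1 ≤ sobolevWeight m μ := by
  have := Finset.single_le_sum (f := fun k => μ ^ k) (s := Finset.range (m + 1))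
    (fun k _ => pow_nonneg hμ k) (Finset.mem_range.2 (Nat.succ_pos m))
  simpa [sobolevWeight] using this

/-- All energy estimates of a mode together, with a constant that does not depend on the
frequency. -/
theorem IsMode.estimate {T μ b₀ b₁ : ℝ} {f y z w : ℝ → ℝ} (h : IsMode T μ b₀ b₁ f y z w)
    (hT : 0 ≤ T) (hμ : 0 ≤ μ) {C R : ℝ} (hC : C = 25 + 5 * Real.exp (3 * T))
    (hR : R = sobolevWeight 3 μ * b₀ ^ 2 + sobolevWeight 1 μ * b₁ ^ 2 +
      ∫ t in Ioo 0 T, f t ^ 2) :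
    sobolevWeight 4 μ * ∫ t in Ioo 0 T, y t ^ 2 ≤ C * R ∧
      sobolevWeight 2 μ * ∫ t in Ioo 0 T, z t ^ 2 ≤ C * R ∧
      ∫ t in Ioo 0 T, w t ^ 2 ≤ C * R := by
  obtain ⟨hy, hz⟩ := h.continuousOn hT
  have iy : Integrable (fun t => y t ^ 2) (volume.restrict (Ioo 0 T)) :=
    integrable_of_continuousOn (hy.pow 2)
  have iz : Integrable (fun t => z t ^ 2) (volume.restrict (Ioo 0 T)) :=
    integrable_of_continuousOn (hz.pow 2)
  have if2 := h.memLp.integrable_sq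
  obtain ⟨h1, h2⟩ := h.maximal_regularity hT hμ
  have h3 := h.weighted_energy hT hμ (γ := 3) (by norm_num)
  have h4 := integral_le_exp_mul_weighted (γ := 3) (by norm_num) (iy.add iz)
    (fun t => by simp only [Pi.add_apply]; positivity)
  simp only [Pi.add_apply] at h4
  rw [integral_add iy iz] at h4
  have h5 := weighted_le_integral (γ := 3) (by norm_num) if2 (fun t => sq_nonneg _)
  rw [integral_const_mul] at h1 h2
  set Y := ∫ t in Ioo 0 T, y t ^ 2
  set Z := ∫ t in Ioo 0 T, z t ^ 2
  set F := ∫ t in Ioo 0 T, f t ^ 2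
  have hY : 0 ≤ Y := integral_nonneg fun t => sq_nonneg _
  have hZ : 0 ≤ Z := integral_nonneg fun t => sq_nonneg _
  have hF : 0 ≤ F := integral_nonneg fun t => sq_nonneg _
  simp only [sobolevWeight, Finset.sum_range_succ, Finset.sum_range_zero, pow_zero, zero_add,
    pow_one] at hR ⊢
  have q0 := sq_nonneg b₀
  have q1 := sq_nonneg b₁
  have a1 : 0 ≤ μ * b₀ ^ 2 := by positivity
  have a2 : 0 ≤ μ ^ 2 * b₀ ^ 2 := by positivity
  have a3 : 0 ≤ μ ^ 3 * b₀ ^ 2 := by positivity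
  have a4 : 0 ≤ μ * b₁ ^ 2 := by positivity
  have hF0 : μ ^ 3 * b₀ ^ 2 + μ * b₁ ^ 2 + F ≤ R := by rw [hR]; linarith
  have hE0 : (1 + μ ^ 2) * b₀ ^ 2 + b₁ ^ 2 + F ≤ R := by rw [hR]; linarith
  have hR0 : 0 ≤ R := by rw [hR]; positivity
  set K := Real.exp (3 * T) with hK
  have hK0 : 0 < K := Real.exp_pos _
  have h6 : Y + Z ≤ K * R := h4.trans (mul_le_mul_of_nonneg_left (by linarith) hK0.le)
  have hKR : 0 ≤ K * R := by positivity
  -- The intermediate powers are dominated by the extreme ones.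
  have w4 : 1 + μ + μ ^ 2 + μ ^ 3 + μ ^ 4 ≤ 5 * (1 + μ ^ 4) := by
    nlinarith [sq_nonneg (μ - 1), sq_nonneg (μ ^ 2 - 1), sq_nonneg (μ ^ 2 - μ)]
  have w2 : 1 + μ + μ ^ 2 ≤ 3 * (1 + μ ^ 2) := by nlinarith [sq_nonneg (μ - 1)]
  refine ⟨?_, ?_, ?_⟩
  · have := mul_le_mul_of_nonneg_right w4 hY
    rw [hC]; nlinarith
  · have := mul_le_mul_of_nonneg_right w2 hZ
    rw [hC]; nlinarith
  · have hle : ∫ t in Ioo 0 T, w t ^ 2 ≤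
        ∫ t in Ioo 0 T, (3 * f t ^ 2 + (3 * μ ^ 2) * z t ^ 2 + (3 * μ ^ 4) * y t ^ 2) := by
      refine integral_mono_of_nonneg (Filter.Eventually.of_forall fun t => sq_nonneg _)
        (((if2.const_mul 3).add (iz.const_mul _)).add (iy.const_mul _)) ?_
      filter_upwards [h.equation] with t ht
      have hw : w t = f t - μ * z t - μ ^ 2 * y t := by linarith
      rw [hw]
      nlinarith [sq_nonneg (f t + μ * z t), sq_nonneg (f t + μ ^ 2 * y t),
        sq_nonneg (μ * z t - μ ^ 2 * y t)]
    have i3 : Integrable (fun t => 3 * f t ^ 2 + (3 * μ ^ 2) * z t ^ 2)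
        (volume.restrict (Ioo 0 T)) := (if2.const_mul 3).add (iz.const_mul _)
    rw [integral_add i3 (iy.const_mul _),
      integral_add (if2.const_mul 3) (iz.const_mul _), integral_const_mul, integral_const_mul,
      integral_const_mul] at hle
    rw [hC]; nlinarith

/-! ### Square integrable functions of time -/

section TimeNorm

variable {T : ℝ} {X : Type} [NormedAddCommGroup X]

theorem L2Time.integrable_norm_sq (u : L2Time T X) :
    Integrable (fun t => ‖u t‖ ^ 2) (volume.restrict (Ioo 0 T)) :=
  (Lp.memLp u).integrable_norm_pow two_ne_zero

theorem L2Time.norm_sq_eq (u : L2Time T X) : ‖u‖ ^ 2 = ∫ t in Ioo 0 T, ‖u t‖ ^ 2 := by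
  have h0 : 0 ≤ ∫ t in Ioo 0 T, ‖u t‖ ^ 2 := integral_nonneg fun t => sq_nonneg _
  rw [Lp.norm_def, (Lp.memLp u).eLpNorm_eq_integral_rpow_norm two_ne_zero ENNReal.ofNat_ne_top]
  simp only [ENNReal.toReal_ofNat, Real.rpow_ofNat]
  rw [ENNReal.toReal_ofReal (Real.rpow_nonneg h0 _), ← Real.rpow_natCast, ← Real.rpow_mul h0]
  norm_num

/-- The square of the norm of `L²(0,T;X)` with the weight `exp (-γ t)`. -/
noncomputable def weightedSq (γ : ℝ) (u : L2Time T X) : ℝ := ∫ t in Ioo 0 T, Real.exp (-γ * t) * ‖u t‖ ^ 2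

theorem weightedSq_zero (u : L2Time T X) : weightedSq 0 u = ‖u‖ ^ 2 := by
  rw [L2Time.norm_sq_eq]; simp [weightedSq]

theorem weightedSq_le_norm_sq (γ : ℝ) (hγ : 0 ≤ γ) (u : L2Time T X) : weightedSq γ u ≤ ‖u‖ ^ 2 := by
  rw [L2Time.norm_sq_eq]
  exact weighted_le_integral hγ u.integrable_norm_sq fun t => sq_nonneg _

theorem norm_sq_le_weightedSq (γ : ℝ) (hγ : 0 ≤ γ) (u : L2Time T X) :
    ‖u‖ ^ 2 ≤ Real.exp (γ * T) * weightedSq γ u := by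
  rw [L2Time.norm_sq_eq]
  exact integral_le_exp_mul_weighted hγ u.integrable_norm_sq fun t => sq_nonneg _

theorem weightedSq_mono {Y : Type} [NormedAddCommGroup Y] (γ M : ℝ) {u : L2Time T X}
    {v : L2Time T Y} (h : ∀ᵐ t ∂(volume.restrict (Ioo 0 T)), ‖u t‖ ^ 2 ≤ M * ‖v t‖ ^ 2) :
    weightedSq γ u ≤ M * weightedSq γ v := by
  rw [weightedSq, weightedSq, ← integral_const_mul]
  refine integral_mono_ae (integrable_weight_mul γ u.integrable_norm_sq)
    ((integrable_weight_mul γ v.integrable_norm_sq).const_mul M) ?_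
  filter_upwards [h] with t ht
  have := mul_le_mul_of_nonneg_left ht (Real.exp_pos (-γ * t)).le
  linarith

theorem weightedSq_add_le (γ : ℝ) (u v : L2Time T X) :
    weightedSq γ (u + v) ≤ 2 * weightedSq γ u + 2 * weightedSq γ v := by
  have iu := (integrable_weight_mul γ u.integrable_norm_sq).const_mul 2
  have iv := (integrable_weight_mul γ v.integrable_norm_sq).const_mul 2
  rw [weightedSq, weightedSq, weightedSq, ← integral_const_mul, ← integral_const_mul,
    ← integral_add iu iv]
  refine integral_mono_ae (integrable_weight_mul γ (u + v).integrable_norm_sq) (iu.add iv) ?_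
  filter_upwards [Lp.coeFn_add u v] with t ht
  rw [ht, Pi.add_apply]
  have h1 : ‖u t + v t‖ ^ 2 ≤ 2 * ‖u t‖ ^ 2 + 2 * ‖v t‖ ^ 2 := by
    have := norm_add_le (u t) (v t)
    have h2 : ‖u t + v t‖ ^ 2 ≤ (‖u t‖ + ‖v t‖) ^ 2 := by gcongr
    nlinarith [sq_nonneg (‖u t‖ - ‖v t‖)]
  have := mul_le_mul_of_nonneg_left h1 (Real.exp_pos (-γ * t)).le
  linarith

/-- A map that contracts a weighted norm has a fixed point, since one of its iterates contracts
the norm of `L²(0,T;X)`. -/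
theorem exists_fixedPoint_of_weightedSq [CompleteSpace X] {γ : ℝ} (hγ : 0 ≤ γ)
    (Φ : L2Time T X → L2Time T X)
    (h : ∀ u v, weightedSq γ (Φ u - Φ v) ≤ 1 / 4 * weightedSq γ (u - v)) :
    ∃ u, Φ u = u := by
  have hit (m : ℕ) (u v : L2Time T X) :
      weightedSq γ (Φ^[m] u - Φ^[m] v) ≤ (1 / 4) ^ m * weightedSq γ (u - v) := by
    induction m with
    | zero => simp
    | succ m ih =>
      rw [Function.iterate_succ_apply', Function.iterate_succ_apply']
      calc _ ≤ _ := h _ _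
        _ ≤ 1 / 4 * ((1 / 4) ^ m * weightedSq γ (u - v)) := by gcongr
        _ = _ := by ring
  obtain ⟨m, hm⟩ : ∃ m : ℕ, Real.exp (γ * T) * (1 / 4) ^ m < 1 / 4 := by
    obtain ⟨m, hm⟩ := exists_pow_lt_of_lt_one
      (show 0 < 1 / 4 / Real.exp (γ * T) by positivity) (show (1 / 4 : ℝ) < 1 by norm_num)
    refine ⟨m, ?_⟩
    rw [lt_div_iff₀ (Real.exp_pos _)] at hm
    linarith
  have hc : ContractingWith (1 / 2) Φ^[m] := by
    refine ⟨by rw [← NNReal.coe_lt_coe]; norm_num, LipschitzWith.of_dist_le_mul fun u v => ?_⟩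
    rw [dist_eq_norm, dist_eq_norm]
    have h1 : ‖Φ^[m] u - Φ^[m] v‖ ^ 2 ≤ 1 / 4 * ‖u - v‖ ^ 2 :=
      calc _ ≤ Real.exp (γ * T) * weightedSq γ (Φ^[m] u - Φ^[m] v) :=
            norm_sq_le_weightedSq γ hγ _
        _ ≤ Real.exp (γ * T) * ((1 / 4) ^ m * weightedSq γ (u - v)) := by
            gcongr; exact hit m u v
        _ ≤ Real.exp (γ * T) * ((1 / 4) ^ m * ‖u - v‖ ^ 2) := by
            gcongr; exact weightedSq_le_norm_sq γ hγ _
        _ = Real.exp (γ * T) * (1 / 4) ^ m * ‖u - v‖ ^ 2 := by ring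
        _ ≤ _ := by gcongr
    refine abs_le_of_sq_le_sq' ?_ (by positivity) |>.2
    simp only [NNReal.coe_div, NNReal.coe_one, NNReal.coe_ofNat]
    nlinarith
  exact ⟨_, hc.isFixedPt_fixedPoint_iterate⟩

end TimeNorm

theorem L2Time.integrable {T : ℝ} {X : Type} [NormedAddCommGroup X] (u : L2Time T X) :
    Integrable u (volume.restrict (Ioo 0 T)) :=
  (Lp.memLp u).integrable one_le_two

theorem memLp_of_continuousOn {T : ℝ} {g : ℝ → ℝ} (hg : ContinuousOn g (Icc 0 T)) :
    MemLp g 2 (volume.restrict (Ioo 0 T)) := by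
  obtain ⟨C, hC⟩ := (isCompact_Icc (a := (0 : ℝ)) (b := T)).exists_bound_of_continuousOn hg
  refine MemLp.of_bound (integrable_of_continuousOn hg).aestronglyMeasurable C ?_
  filter_upwards [ae_restrict_mem measurableSet_Ioo] with t ht
  exact hC t (Ioo_subset_Icc_self ht)

/-- Every mode has a solution: `w = y''` is the fixed point of `w ↦ f - μ y' - μ² y`, which
contracts a weighted norm if the weight is strong. -/
theorem exists_isMode {T : ℝ} (hT : 0 < T) {μ : ℝ} (hμ : 0 ≤ μ) (b₀ b₁ : ℝ) (f : L2Time T ℝ) :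
    ∃ (y z : ℝ → ℝ) (w : L2Time T ℝ), IsMode T μ b₀ b₁ f y z w := by
  let zz (w : L2Time T ℝ) : ℝ → ℝ := fun t => b₁ + ∫ s in (0 : ℝ)..t, w s
  have hzz (w : L2Time T ℝ) : IsPrimitive T (zz w) w := .of_integrableOn hT.le b₁ w.integrable
  have hzc (w : L2Time T ℝ) := (hzz w).continuousOn hT.le
  let yy (w : L2Time T ℝ) : ℝ → ℝ := fun t => b₀ + ∫ s in (0 : ℝ)..t, zz w s
  have hyy (w : L2Time T ℝ) : IsPrimitive T (yy w) (zz w) :=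
    .of_integrableOn hT.le b₀ (integrable_of_continuousOn (hzc w))
  have hyc (w : L2Time T ℝ) := (hyy w).continuousOn hT.le
  have hm (w : L2Time T ℝ) : MemLp (fun t => μ * zz w t + μ ^ 2 * yy w t) 2
      (volume.restrict (Ioo 0 T)) :=
    memLp_of_continuousOn ((continuousOn_const.mul (hzc w)).add (continuousOn_const.mul (hyc w)))
  let Φ (w : L2Time T ℝ) : L2Time T ℝ := f - (hm w).toLp
  -- For this `γ`, the bounds `4 / γ²` for `y'` and `16 / γ⁴` for `y` in terms of `w` absorb the
  -- coefficients `μ` and `μ²`.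
  set γ : ℝ := 8 * (1 + μ + μ ^ 2) with hγ
  have hγ1 : 8 ≤ γ := by rw [hγ]; nlinarith
  obtain ⟨w, hw⟩ := exists_fixedPoint_of_weightedSq (γ := γ) (by linarith) Φ fun u v => by
    set d := u - v with hd
    have hz : IsPrimitive T (fun t => zz u t + (-1) * zz v t) d := by
      refine ((hzz u).add ((hzz v).const_mul (-1))).congr_deriv hT.le ?_
      filter_upwards [Lp.coeFn_sub u v] with t ht
      rw [hd, ht, Pi.sub_apply]; ring
    have hy : IsPrimitive T (fun t => yy u t + (-1) * yy v t)
        (fun t => zz u t + (-1) * zz v t) := (hyy u).add ((hyy v).const_mul (-1))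
    have hd2 : Integrable (fun t => d t ^ 2) (volume.restrict (Ioo 0 T)) := by
      simpa using d.integrable_norm_sq
    have k1 := hz.weighted_sq_le hT.le (γ := γ) (by linarith) (by simp [zz]) hd2
    have cz := hz.continuousOn hT.le
    have cy := hy.continuousOn hT.le
    have iz : Integrable (fun t => (zz u t + (-1) * zz v t) ^ 2) (volume.restrict (Ioo 0 T)) :=
      integrable_of_continuousOn (cz.pow 2)
    have iy : Integrable (fun t => (yy u t + (-1) * yy v t) ^ 2) (volume.restrict (Ioo 0 T)) :=
      integrable_of_continuousOn (cy.pow 2)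
    have k2 := hy.weighted_sq_le hT.le (γ := γ) (by linarith) (by simp [yy]) iz
    have k3 : weightedSq γ (Φ u - Φ v) ≤
        ∫ t in Ioo 0 T, (2 * μ ^ 2 * (Real.exp (-γ * t) * (zz u t + (-1) * zz v t) ^ 2) +
          2 * μ ^ 4 * (Real.exp (-γ * t) * (yy u t + (-1) * yy v t) ^ 2)) := by
      refine integral_mono_ae (integrable_weight_mul γ (Φ u - Φ v).integrable_norm_sq)
        (((integrable_weight_mul γ iz).const_mul _).add
          ((integrable_weight_mul γ iy).const_mul _)) ?_
      have e : Φ u - Φ v = (hm v).toLp - (hm u).toLp := by simp only [Φ]; abel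
      rw [e]
      filter_upwards [Lp.coeFn_sub ((hm v).toLp) ((hm u).toLp), (hm u).coeFn_toLp,
        (hm v).coeFn_toLp] with t h1 h2 h3
      rw [h1, Pi.sub_apply, h2, h3, Real.norm_eq_abs, sq_abs]
      have : (μ * zz v t + μ ^ 2 * yy v t - (μ * zz u t + μ ^ 2 * yy u t)) ^ 2 ≤
          2 * μ ^ 2 * (zz u t + (-1) * zz v t) ^ 2 +
            2 * μ ^ 4 * (yy u t + (-1) * yy v t) ^ 2 := by
        nlinarith [sq_nonneg (μ * (zz u t - zz v t) - μ ^ 2 * (yy u t - yy v t))]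
      have := mul_le_mul_of_nonneg_left this (Real.exp_pos (-γ * t)).le
      linarith
    rw [integral_add ((integrable_weight_mul γ iz).const_mul _)
      ((integrable_weight_mul γ iy).const_mul _), integral_const_mul, integral_const_mul] at k3
    have k4 : weightedSq γ d = ∫ t in Ioo 0 T, Real.exp (-γ * t) * d t ^ 2 := by
      simp [weightedSq]
    rw [← k4] at k1
    have hD : 0 ≤ weightedSq γ d := integral_nonneg fun t => by positivity
    set Z := ∫ t in Ioo 0 T, Real.exp (-γ * t) * (zz u t + (-1) * zz v t) ^ 2
    set Y := ∫ t in Ioo 0 T, Real.exp (-γ * t) * (yy u t + (-1) * yy v t) ^ 2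
    have g1 : 2 * μ ^ 2 * (4 / γ ^ 2) ≤ 1 / 8 := by
      rw [mul_div_assoc', div_le_div_iff₀ (by positivity) (by norm_num)]
      have : (8 * μ) ^ 2 ≤ γ ^ 2 := by gcongr; rw [hγ]; nlinarith
      linarith
    have g2 : 2 * μ ^ 4 * (4 / γ ^ 2 * (4 / γ ^ 2)) ≤ 1 / 8 := by
      rw [div_mul_div_comm, mul_div_assoc', div_le_div_iff₀ (by positivity) (by norm_num)]
      have h1 : (8 * μ) ^ 2 ≤ γ ^ 2 := by gcongr; rw [hγ]; nlinarith
      have h2 : (8 * μ) ^ 2 * (8 * μ) ^ 2 ≤ γ ^ 2 * γ ^ 2 := by gcongr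
      nlinarith
    calc weightedSq γ (Φ u - Φ v) ≤ 2 * μ ^ 2 * Z + 2 * μ ^ 4 * Y := k3
      _ ≤ 2 * μ ^ 2 * (4 / γ ^ 2 * weightedSq γ d) +
          2 * μ ^ 4 * (4 / γ ^ 2 * (4 / γ ^ 2 * weightedSq γ d)) := by
        have : Y ≤ 4 / γ ^ 2 * (4 / γ ^ 2 * weightedSq γ d) :=
          k2.trans (mul_le_mul_of_nonneg_left k1 (by positivity))
        gcongr
      _ = (2 * μ ^ 2 * (4 / γ ^ 2) + 2 * μ ^ 4 * (4 / γ ^ 2 * (4 / γ ^ 2))) *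
          weightedSq γ d := by ring
      _ ≤ (1 / 8 + 1 / 8) * weightedSq γ d := by gcongr
      _ = _ := by ring
  refine ⟨yy w, zz w, w, hyy w, hzz w, by simp [yy], by simp [zz], Lp.memLp f, ?_⟩
  have e : w = f - (hm w).toLp := hw.symm
  filter_upwards [Lp.coeFn_sub f (hm w).toLp, (hm w).coeFn_toLp] with t h1 h2
  have : w t = f t - (μ * zz w t + μ ^ 2 * yy w t) := by
    rw [← h2, ← Pi.sub_apply, ← h1, ← e]
  linarith

/-! ### Orthogonal coordinates -/

/-- Orthogonal coordinates on a Banach space `X`: functionals `ℓ n` that diagonalize the square of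
the norm, with positive weights `r n`, and the dual vectors `e n`. -/
structure IsCoordSystem {X : Type} [NormedAddCommGroup X] [NormedSpace ℝ X]
    (ℓ : ℤ → X →L[ℝ] ℝ) (r : ℤ → ℝ) (e : ℤ → X) : Prop where
  pos : ∀ n, 0 < r n
  hasSum : ∀ x, HasSum (fun n => r n * ℓ n x ^ 2) (‖x‖ ^ 2)
  dual : ∀ n m, ℓ n (e m) = if n = m then 1 else 0

/-- The coordinate `t ↦ ℓ (u t)` of an element of `L²(0,T;X)`. -/
noncomputable abbrev timeCoord {T : ℝ} {X : Type} [NormedAddCommGroup X] [NormedSpace ℝ X]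
    (ℓ : X →L[ℝ] ℝ) : L2Time T X →L[ℝ] L2Time T ℝ :=
  ℓ.compLpL 2 (volume.restrict (Ioo 0 T))

theorem coeFn_timeCoord {T : ℝ} {X : Type} [NormedAddCommGroup X] [NormedSpace ℝ X]
    (ℓ : X →L[ℝ] ℝ) (u : L2Time T X) :
    timeCoord ℓ u =ᵐ[volume.restrict (Ioo 0 T)] fun t => ℓ (u t) :=
  ContinuousLinearMap.coeFn_compLpL ℓ u

namespace IsCoordSystem

variable {X : Type} [NormedAddCommGroup X] [NormedSpace ℝ X]
  {ℓ : ℤ → X →L[ℝ] ℝ} {r : ℤ → ℝ} {e : ℤ → X}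

theorem eq_zero (h : IsCoordSystem ℓ r e) {x : X} (hx : ∀ n, ℓ n x = 0) : x = 0 := by
  have h1 := h.hasSum x
  simp only [hx, ne_eq, OfNat.ofNat_ne_zero, not_false_eq_true, zero_pow, mul_zero] at h1
  have h2 := h1.unique hasSum_zero
  simpa using h2

theorem ext (h : IsCoordSystem ℓ r e) {x y : X} (hx : ∀ n, ℓ n x = ℓ n y) : x = y :=
  sub_eq_zero.1 (h.eq_zero fun n => by rw [map_sub, hx, sub_self])

theorem hasSum_repr (h : IsCoordSystem ℓ r e) (x : X) : HasSum (fun n => ℓ n x • e n) x := by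
  -- Pythagoras: the remainder of a partial sum is the tail of the series of squares.
  have key (s : Finset ℤ) :
      ‖(∑ n ∈ s, ℓ n x • e n) - x‖ ^ 2 = ‖x‖ ^ 2 - ∑ n ∈ s, r n * ℓ n x ^ 2 := by
    have h1 := h.hasSum ((∑ n ∈ s, ℓ n x • e n) - x)
    have h2 : HasSum (fun n => r n * ℓ n x ^ 2 - if n ∈ s then r n * ℓ n x ^ 2 else 0)
        (‖x‖ ^ 2 - ∑ n ∈ s, if n ∈ s then r n * ℓ n x ^ 2 else 0) :=
      (h.hasSum x).sub (hasSum_sum_of_ne_finset_zero fun n hn => by simp [hn])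
    rw [Finset.sum_congr rfl fun n hn => if_pos hn] at h2
    refine h1.unique (h2.congr_fun ?_)
    intro n
    have : ℓ n ((∑ n ∈ s, ℓ n x • e n) - x) = if n ∈ s then 0 else -ℓ n x := by
      simp only [map_sub, map_sum, map_smul, h.dual, smul_eq_mul, mul_ite, mul_one, mul_zero,
        Finset.sum_ite_eq]
      split_ifs <;> ring
    rw [this]
    split_ifs <;> ring
  have lim : Filter.Tendsto (fun s : Finset ℤ => ‖(∑ n ∈ s, ℓ n x • e n) - x‖ ^ 2)
      Filter.atTop (nhds 0) := by
    simp only [key]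
    have h3 : Filter.Tendsto (fun s : Finset ℤ => ∑ n ∈ s, r n * ℓ n x ^ 2) Filter.atTop
      (nhds (‖x‖ ^ 2)) := h.hasSum x
    have h4 := h3.const_sub (‖x‖ ^ 2)
    rwa [sub_self] at h4
  have lim2 := (Real.continuous_sqrt.tendsto 0).comp lim
  rw [HasSum, SummationFilter.unconditional_filter, tendsto_iff_norm_sub_tendsto_zero]
  simpa [Function.comp_def] using lim2

/-- A function is strongly measurable if its coordinates are. -/
theorem aestronglyMeasurable (h : IsCoordSystem ℓ r e) {α : Type*} [MeasurableSpace α]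
    {ν : Measure α} {f : α → X} (hf : ∀ n, AEStronglyMeasurable (fun a => ℓ n (f a)) ν) :
    AEStronglyMeasurable f ν := by
  refine aestronglyMeasurable_of_tendsto_ae Filter.atTop
    (f := fun (s : Finset ℤ) a => ∑ n ∈ s, ℓ n (f a) • e n) (fun s => ?_)
    (Filter.Eventually.of_forall fun a => ?_)
  · exact Finset.aestronglyMeasurable_fun_sum _ fun n _ => (hf n).smul_const _
  · exact h.hasSum_repr (f a)

variable {T : ℝ}

theorem time_ext (h : IsCoordSystem ℓ r e) {u v : L2Time T X}
    (huv : ∀ n, timeCoord (ℓ n) u = timeCoord (ℓ n) v) : u = v := by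
  refine Lp.ext ?_
  have : ∀ᵐ t ∂(volume.restrict (Ioo 0 T)), ∀ n, ℓ n (u t) = ℓ n (v t) := by
    rw [ae_all_iff]
    intro n
    have h1 := coeFn_timeCoord (ℓ n) u
    have h2 := coeFn_timeCoord (ℓ n) v
    rw [huv n] at h1
    exact h1.symm.trans h2
  filter_upwards [this] with t ht
  exact h.ext ht

theorem hasSum_weightedSq (h : IsCoordSystem ℓ r e) (γ : ℝ) (u : L2Time T X) :
    HasSum (fun n => r n * weightedSq γ (timeCoord (ℓ n) u)) (weightedSq γ u) := by
  have e1 (n : ℤ) : r n * weightedSq γ (timeCoord (ℓ n) u) =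
      ∫ t in Ioo 0 T, Real.exp (-γ * t) * (r n * ℓ n (u t) ^ 2) := by
    rw [weightedSq, ← integral_const_mul]
    refine integral_congr_ae ?_
    filter_upwards [coeFn_timeCoord (ℓ n) u] with t ht
    rw [ht, Real.norm_eq_abs, sq_abs]; ring
  simp only [e1]
  have hs (t : ℝ) : HasSum (fun n => Real.exp (-γ * t) * (r n * ℓ n (u t) ^ 2))
      (Real.exp (-γ * t) * ‖u t‖ ^ 2) := (h.hasSum (u t)).mul_left _
  refine hasSum_integral_of_dominated_convergence
    (fun n t => Real.exp (-γ * t) * (r n * ℓ n (u t) ^ 2)) (fun n => ?_) (fun n => ?_)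
    (Filter.Eventually.of_forall fun t => (hs t).summable) ?_ (Filter.Eventually.of_forall hs)
  · refine (continuous_weight γ).aestronglyMeasurable.mul ?_
    refine AEStronglyMeasurable.const_mul ?_ _
    exact ((ℓ n).continuous.comp_aestronglyMeasurable (Lp.aestronglyMeasurable u)).pow 2
  · refine Filter.Eventually.of_forall fun t => ?_
    have := (h.pos n).le
    rw [Real.norm_of_nonneg (by positivity)]
  · simp only [(hs _).tsum_eq]
    exact integrable_weight_mul γ u.integrable_norm_sq

theorem hasSum_time (h : IsCoordSystem ℓ r e) (u : L2Time T X) :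
    HasSum (fun n => r n * ‖timeCoord (ℓ n) u‖ ^ 2) (‖u‖ ^ 2) := by
  simpa only [weightedSq_zero] using h.hasSum_weightedSq 0 u

/-- The Riesz–Fischer theorem for coordinates that depend on time. -/
theorem exists_timeCoord_eq [CompleteSpace X] (h : IsCoordSystem ℓ r e) (Y : ℤ → L2Time T ℝ)
    (hY : Summable fun n => r n * ‖Y n‖ ^ 2) : ∃ u : L2Time T X, ∀ n, timeCoord (ℓ n) u = Y n := by
  let V (n : ℤ) : L2Time T X :=
    (ContinuousLinearMap.toSpanSingleton ℝ (e n)).compLpL 2 (volume.restrict (Ioo 0 T)) (Y n)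
  have hV (n m : ℤ) : timeCoord (ℓ n) (V m) = if n = m then Y n else 0 := by
    refine Lp.ext ?_
    have h2 := ContinuousLinearMap.coeFn_compLpL (p := 2) (μ := volume.restrict (Ioo 0 T))
      (ContinuousLinearMap.toSpanSingleton ℝ (e m)) (Y m)
    have h3 : ⇑(if n = m then Y n else 0 : L2Time T ℝ) =ᵐ[volume.restrict (Ioo 0 T)]
        fun t => Y m t * if n = m then 1 else 0 := by
      split_ifs with hnm
      · subst hnm; simp
      · filter_upwards [Lp.coeFn_zero ℝ 2 (volume.restrict (Ioo 0 T))] with t ht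
        rw [ht]; simp
    filter_upwards [coeFn_timeCoord (ℓ n) (V m), h2, h3] with t a1 a2 a3
    rw [a1, a3, a2, ContinuousLinearMap.toSpanSingleton_apply, map_smul, h.dual, smul_eq_mul]
  have hVs (s : Finset ℤ) (n : ℤ) :
      timeCoord (ℓ n) (∑ m ∈ s, V m) = if n ∈ s then Y n else 0 := by
    rw [map_sum, Finset.sum_congr rfl fun m _ => hV n m]
    simp
  have hnorm (s : Finset ℤ) : ‖∑ m ∈ s, V m‖ ^ 2 = ∑ n ∈ s, r n * ‖Y n‖ ^ 2 := by
    refine (h.hasSum_time _).unique ?_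
    simp only [hVs]
    have := hasSum_sum_of_ne_finset_zero (s := s) (L := SummationFilter.unconditional ℤ)
      (f := fun n => r n * ‖if n ∈ s then Y n else 0‖ ^ 2) fun n hn => by simp [hn]
    rwa [Finset.sum_congr rfl fun n hn => by rw [if_pos hn]] at this
  have hsum : Summable V := by
    rw [summable_iff_vanishing_norm] at hY ⊢
    intro ε hε
    obtain ⟨s, hs⟩ := hY (ε ^ 2) (by positivity)
    refine ⟨s, fun t ht => ?_⟩
    have h4 := (le_abs_self _).trans_lt (hs t ht)
    rw [← hnorm] at h4
    exact lt_of_pow_lt_pow_left₀ 2 hε.le h4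
  refine ⟨∑' n, V n, fun n => ?_⟩
  have h5 := (timeCoord (T := T) (ℓ n)).hasSum hsum.hasSum
  simp only [hV] at h5
  refine h5.unique ?_
  have h6 := hasSum_ite_eq n (Y n)
  refine h6.congr_fun fun m => ?_
  by_cases hmn : m = n
  · simp [hmn]
  · simp [hmn, Ne.symm hmn]

end IsCoordSystem

/-! ### The trigonometric basis of the torus -/

section Torus

variable {P : ℝ}

/-- The `n`-th wave number `2πn/P`. -/
noncomputable def waveNumber (P : ℝ) (n : ℤ) : ℝ := 2 * Real.pi * n / P

/-- The normalized Hartley functions `(cos (κ x) + sin (κ x)) / √P`, where `κ = 2πn/P`. They form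
a real orthonormal basis of `L²` indexed by all integers, and differentiation takes the one of
index `n` to `κ` times the one of index `-n`. -/
noncomputable def hartley (P : ℝ) (n : ℤ) (x : AddCircle P) : ℝ :=
  ((fourier n x : ℂ).re + (fourier n x : ℂ).im) / √P

theorem hartley_coe (n : ℤ) (y : ℝ) :
    hartley P n (y : AddCircle P) =
      (Real.cos (waveNumber P n * y) + Real.sin (waveNumber P n * y)) / √P := by
  have : (2 * Real.pi * Complex.I * n * y / P : ℂ) = ((waveNumber P n * y : ℝ) : ℂ) * Complex.I := by
    simp only [waveNumber]; push_cast; ring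
  rw [hartley, fourier_coe_apply, this, Complex.exp_ofReal_mul_I_re, Complex.exp_ofReal_mul_I_im]

theorem continuous_hartley (n : ℤ) : Continuous (hartley P n) := by
  have h : Continuous fun x : AddCircle P => (fourier n x : ℂ) := (fourier n).continuous
  exact ((Complex.continuous_re.comp h).add (Complex.continuous_im.comp h)).div_const _

theorem smoothTorus_hartley (n : ℤ) : SmoothTorus (hartley P n) := by
  unfold SmoothTorus
  simp only [hartley_coe]
  fun_prop

theorem waveNumber_neg (n : ℤ) : waveNumber P (-n) = -waveNumber P n := by
  simp only [waveNumber]; push_cast; ring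

theorem hasDerivAt_hartley (n : ℤ) (y : ℝ) :
    HasDerivAt (fun y : ℝ => hartley P n (y : AddCircle P))
      (waveNumber P n * hartley P (-n) (y : AddCircle P)) y := by
  simp only [hartley_coe, waveNumber_neg]
  have h0 : HasDerivAt (fun y : ℝ => waveNumber P n * y) (waveNumber P n) y := by
    simpa using (hasDerivAt_id y).const_mul (waveNumber P n)
  have := (h0.cos.add h0.sin).div_const (√P)
  refine this.congr_deriv ?_
  rw [neg_mul (waveNumber P n), Real.cos_neg, Real.sin_neg]
  ring

/-- Differentiation of functions on the torus in terms of their Hartley coefficients. -/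
noncomputable def coeffDeriv (P : ℝ) (c : ℤ → ℝ) : ℤ → ℝ := fun n => -waveNumber P n * c (-n)

/-- `coeffDeriv` is skew-adjoint; both sides are reindexed by `n ↦ -n`, which needs no
summability. -/
theorem tsum_mul_coeffDeriv_iterate (k : ℕ) (a b : ℤ → ℝ) :
    ∑' n, a n * (coeffDeriv P)^[k] b n = (-1) ^ k * ∑' n, (coeffDeriv P)^[k] a n * b n := by
  induction k generalizing a with
  | zero => simp
  | succ k ih =>
    have h1 (c d : ℤ → ℝ) : ∑' n, c n * coeffDeriv P d n = -∑' n, coeffDeriv P c n * d n := by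
      rw [← (Equiv.neg ℤ).tsum_eq, ← tsum_neg]
      refine tsum_congr fun n => ?_
      simp only [coeffDeriv, Equiv.neg_apply, neg_neg, waveNumber_neg]; ring
    rw [Function.iterate_succ_apply', h1, ih, Function.iterate_succ_apply, pow_succ]
    ring

/-- The eigenvalue `(2πn/P)²` of `-∂_xx`. -/
noncomputable def freq (P : ℝ) (n : ℤ) : ℝ := waveNumber P n ^ 2

theorem freq_nonneg (n : ℤ) : 0 ≤ freq P n := sq_nonneg _

/-- The squared norm of a `k`-th derivative in terms of the coefficients of the function itself; the
reindexing by `n ↦ -n` needs an even weight `w`. -/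
theorem hasSum_of_coeffDeriv_iterate (k : ℕ) {w c : ℤ → ℝ} (hw : ∀ n, w (-n) = w n) {S : ℝ}
    (h : HasSum (fun n => w n * (coeffDeriv P)^[k] c n ^ 2) S) :
    HasSum (fun n => w n * freq P n ^ k * c n ^ 2) S := by
  induction k generalizing c with
  | zero => simpa using h
  | succ k ih =>
    rw [Function.iterate_succ] at h
    have h1 := ih h
    rw [← (Equiv.neg ℤ).hasSum_iff] at h1
    refine h1.congr_fun fun n => ?_
    simp only [Function.comp_apply, Equiv.neg_apply, hw, freq, coeffDeriv, waveNumber_neg, neg_neg]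
    ring

variable [hP : Fact (0 < P)]

theorem integral_fourier (k : ℤ) :
    ∫ x : AddCircle P, (fourier k x : ℂ) = if k = 0 then (P : ℂ) else 0 := by
  split_ifs with h
  · subst h
    simp [Measure.real, AddCircle.measure_univ, hP.out.le]
  · exact integral_eq_zero_of_add_right_eq_neg (μ := (volume : Measure (AddCircle P)))
      (fourier_add_half_inv_index h hP.out)

theorem integrable_of_continuous {E : Type*} [NormedAddCommGroup E] {ψ : AddCircle P → E}
    (h : Continuous ψ) : Integrable ψ :=
  h.integrable_of_hasCompactSupport (HasCompactSupport.of_compactSpace ψ)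

theorem integral_hartley_mul (n m : ℤ) :
    ∫ x, hartley P n x * hartley P m x = if n = m then 1 else 0 := by
  have e (x : AddCircle P) : hartley P n x * hartley P m x =
      ((fourier (n - m) x : ℂ).re + (fourier (n + m) x : ℂ).im) / P := by
    have h1 : (fourier (n - m) x : ℂ) = fourier n x * (starRingEnd ℂ) (fourier m x) := by
      rw [sub_eq_add_neg, fourier_add, fourier_neg]
    have h2 : √P * √P = P := Real.mul_self_sqrt hP.out.le
    rw [h1, fourier_add]
    simp only [hartley, Complex.mul_re, Complex.mul_im, Complex.conj_re, Complex.conj_im]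
    rw [div_mul_div_comm, h2]
    ring
  have i (k : ℤ) : Integrable fun x : AddCircle P => (fourier k x : ℂ) :=
    integrable_of_continuous (fourier k).continuous
  have i1 : Integrable fun x : AddCircle P => (fourier (n - m) x : ℂ).re := (i _).re
  have i2 : Integrable fun x : AddCircle P => (fourier (n + m) x : ℂ).im := (i _).im
  have hre : ∫ x : AddCircle P, (fourier (n - m) x : ℂ).re =
      (∫ x : AddCircle P, (fourier (n - m) x : ℂ)).re := integral_re (i _)
  have him : ∫ x : AddCircle P, (fourier (n + m) x : ℂ).im =
      (∫ x : AddCircle P, (fourier (n + m) x : ℂ)).im := integral_im (i _)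
  simp only [e]
  rw [integral_div, integral_add i1 i2, hre, him, integral_fourier, integral_fourier]
  have hP0 : P ≠ 0 := hP.out.ne'
  have h3 : (if n + m = 0 then (P : ℂ) else 0).im = 0 := by split_ifs <;> simp
  rw [h3, add_zero]
  simp only [sub_eq_zero]
  split_ifs <;> simp [hP0]

theorem memLp_of_continuous {ψ : AddCircle P → ℝ} (h : Continuous ψ) :
    MemLp ψ 2 (volume : Measure (AddCircle P)) := by
  obtain ⟨C, hC⟩ := isCompact_univ.exists_bound_of_continuousOn h.continuousOn
  exact MemLp.of_bound h.aestronglyMeasurable C (Filter.Eventually.of_forall fun x => hC x trivial)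

/-- A continuous function on the torus as an element of `L²`. -/
noncomputable def toL2 (ψ : AddCircle P → ℝ) (h : Continuous ψ) : L2Torus P :=
  (memLp_of_continuous h).toLp

theorem coeFn_toL2 {ψ : AddCircle P → ℝ} (h : Continuous ψ) : toL2 ψ h =ᵐ[volume] ψ :=
  (memLp_of_continuous h).coeFn_toLp

theorem integral_mul_eq_inner (f : L2Torus P) {ψ : AddCircle P → ℝ} (h : Continuous ψ) :
    ∫ x, f x * ψ x = inner ℝ f (toL2 ψ h) := by
  rw [L2.inner_def]
  refine integral_congr_ae ?_
  filter_upwards [coeFn_toL2 h] with x hx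
  rw [hx]
  simp [mul_comm]

theorem integral_toL2_mul {φ ψ : AddCircle P → ℝ} (hφ : Continuous φ) :
    ∫ x, toL2 φ hφ x * ψ x = ∫ x, φ x * ψ x := by
  refine integral_congr_ae ?_
  filter_upwards [coeFn_toL2 hφ] with x hx
  rw [hx]

/-- The Hartley functions in `L²`. -/
noncomputable def hartleyL2 (P : ℝ) [Fact (0 < P)] (n : ℤ) : L2Torus P :=
  toL2 (hartley P n) (continuous_hartley n)

theorem orthonormal_hartleyL2 : Orthonormal ℝ (hartleyL2 P) := by
  rw [orthonormal_iff_ite]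
  intro n m
  rw [hartleyL2, hartleyL2, ← integral_mul_eq_inner, integral_toL2_mul, integral_hartley_mul]

/-- The Hartley functions are complete, since they span the same functions as the complex
exponentials. -/
theorem eq_zero_of_inner_hartleyL2 {f : L2Torus P} (h : ∀ n, inner ℝ (hartleyL2 P n) f = 0) :
    f = 0 := by
  have hf : Integrable f := (Lp.memLp f).integrable one_le_two
  have hn (n : ℤ) : ∫ x, f x * ((fourier n x : ℂ).re + (fourier n x : ℂ).im) = 0 := by
    have h1 := h n
    rw [real_inner_comm, hartleyL2, ← integral_mul_eq_inner] at h1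
    have h2 : ∫ x, f x * hartley P n x =
        (∫ x, f x * ((fourier n x : ℂ).re + (fourier n x : ℂ).im)) / √P := by
      rw [← integral_div]
      refine integral_congr_ae (Filter.Eventually.of_forall fun x => ?_)
      simp only [hartley]; ring
    rw [h2, div_eq_zero_iff] at h1
    exact h1.resolve_right (Real.sqrt_pos.2 hP.out).ne'
  have bdd (g : AddCircle P → ℝ) (hg : Continuous g) : Integrable fun x => f x * g x := by
    obtain ⟨C, hC⟩ := isCompact_univ.exists_bound_of_continuousOn hg.continuousOn
    exact hf.mul_bdd (c := C) hg.aestronglyMeasurable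
      (Filter.Eventually.of_forall fun x => hC x trivial)
  have cre (n : ℤ) : Continuous fun x : AddCircle P => (fourier n x : ℂ).re :=
    Complex.continuous_re.comp (fourier n).continuous
  have cim (n : ℤ) : Continuous fun x : AddCircle P => (fourier n x : ℂ).im :=
    Complex.continuous_im.comp (fourier n).continuous
  have hsum (n : ℤ) : (∫ x, f x * (fourier n x : ℂ).re) + ∫ x, f x * (fourier n x : ℂ).im = 0 := by
    rw [← integral_add (bdd _ (cre n)) (bdd _ (cim n)), ← hn n]
    refine integral_congr_ae (Filter.Eventually.of_forall fun x => ?_)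
    simp only []; ring
  have hdiff (n : ℤ) :
      (∫ x, f x * (fourier n x : ℂ).re) - ∫ x, f x * (fourier n x : ℂ).im = 0 := by
    rw [← integral_sub (bdd _ (cre n)) (bdd _ (cim n)), ← hn (-n)]
    refine integral_congr_ae (Filter.Eventually.of_forall fun x => ?_)
    simp only [fourier_neg, Complex.conj_re, Complex.conj_im]; ring
  have hc (n : ℤ) : ∫ x : AddCircle P, (fourier n x : ℂ) • (f x : ℂ) = 0 := by
    have hi : Integrable fun x : AddCircle P => (fourier n x : ℂ) • (f x : ℂ) := by
      refine hf.ofReal.bdd_smul (φ := fun x : AddCircle P => (fourier n x : ℂ)) 1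
        (fourier n).continuous.aestronglyMeasurable (Filter.Eventually.of_forall fun x => ?_)
      rw [fourier_apply, Circle.norm_coe]
    apply Complex.ext
    · have e1 : (∫ x : AddCircle P, (fourier n x : ℂ) • (f x : ℂ)).re =
          ∫ x, f x * (fourier n x : ℂ).re := by
        refine (integral_re hi).symm.trans (integral_congr_ae (Filter.Eventually.of_forall ?_))
        intro x; simp [mul_comm]
      rw [e1, Complex.zero_re]; linarith [hsum n, hdiff n]
    · have e1 : (∫ x : AddCircle P, (fourier n x : ℂ) • (f x : ℂ)).im =
          ∫ x, f x * (fourier n x : ℂ).im := by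
        refine (integral_im hi).symm.trans (integral_congr_ae (Filter.Eventually.of_forall ?_))
        intro x; simp [mul_comm]
      rw [e1, Complex.zero_im]; linarith [hsum n, hdiff n]
  have hm : MemLp (fun x => (f x : ℂ)) 2 (AddCircle.haarAddCircle (T := P)) :=
    ((Lp.memLp f).ofReal (K := ℂ)).haarAddCircle
  have hg : hm.toLp = 0 := by
    apply fourierBasis.repr.injective
    rw [map_zero]
    ext n
    rw [fourierBasis_repr, fourierCoeff_congr_ae hm.coeFn_toLp, fourierCoeff,
      AddCircle.integral_haarAddCircle, hc, smul_zero]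
    rfl
  have h0 : (fun x => (f x : ℂ)) =ᵐ[AddCircle.haarAddCircle (T := P)] 0 := by
    have := hm.coeFn_toLp
    rw [hg] at this
    exact this.symm.trans (Lp.coeFn_zero _ _ _)
  have h1 : (fun x => (f x : ℂ)) =ᵐ[(volume : Measure (AddCircle P))] 0 :=
    Measure.ae_smul_measure h0 (ENNReal.ofReal P)
  refine (Lp.eq_zero_iff_ae_eq_zero).2 ?_
  filter_upwards [h1] with x hx
  simpa using hx

/-- The Hartley basis of `L²`. -/
noncomputable def hartleyBasis (P : ℝ) [Fact (0 < P)] : HilbertBasis ℤ ℝ (L2Torus P) :=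
  HilbertBasis.mkOfOrthogonalEqBot (orthonormal_hartleyL2 (P := P)) (by
    rw [Submodule.eq_bot_iff]
    intro f hf
    refine eq_zero_of_inner_hartleyL2 fun n => ?_
    exact Submodule.inner_right_of_mem_orthogonal (Submodule.subset_span (mem_range_self n)) hf)

theorem hartleyBasis_apply (n : ℤ) : hartleyBasis P n = hartleyL2 P n := by
  rw [hartleyBasis, HilbertBasis.coe_mkOfOrthogonalEqBot]

/-- The `n`-th Hartley coefficient. -/
noncomputable def coeff (P : ℝ) [Fact (0 < P)] (n : ℤ) : L2Torus P →L[ℝ] ℝ :=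
  innerSL ℝ (hartleyL2 P n)

theorem coeff_apply (n : ℤ) (f : L2Torus P) : coeff P n f = inner ℝ (hartleyL2 P n) f := rfl

theorem coeff_toL2 (n : ℤ) {φ : AddCircle P → ℝ} (h : Continuous φ) :
    coeff P n (toL2 φ h) = ∫ x, φ x * hartley P n x := by
  rw [coeff_apply, real_inner_comm, hartleyL2, ← integral_mul_eq_inner, integral_toL2_mul]

theorem tsum_coeff_mul_coeff (f g : L2Torus P) :
    ∑' n, coeff P n f * coeff P n g = inner ℝ f g := by
  rw [← (hartleyBasis P).tsum_inner_mul_inner f g]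
  simp only [hartleyBasis_apply, coeff_apply, real_inner_comm]

theorem isCoordSystem_L2Torus : IsCoordSystem (coeff P) (fun _ => 1) (hartleyL2 P) where
  pos _ := one_pos
  hasSum f := by
    have := (hartleyBasis P).hasSum_inner_mul_inner f f
    rw [real_inner_self_eq_norm_sq] at this
    refine this.congr_fun fun n => ?_
    rw [hartleyBasis_apply, coeff_apply, real_inner_comm]; ring
  dual n m := by rw [coeff_apply, orthonormal_iff_ite.1 orthonormal_hartleyL2]

/-! ### Weak derivatives on the torus -/

theorem torusDeriv_coe (k : ℕ) (φ : AddCircle P → ℝ) (y : ℝ) :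
    torusDeriv k φ (y : AddCircle P) = iteratedDeriv k (fun y : ℝ => φ (y : AddCircle P)) y := by
  have hper : Function.Periodic (iteratedDeriv k (fun y : ℝ => φ (y : AddCircle P))) P := by
    intro x
    have e : (fun y : ℝ => φ (y : AddCircle P)) = fun y : ℝ => φ ((y + P : ℝ) : AddCircle P) := by
      funext y; simp
    have := congrFun (iteratedDeriv_comp_add_const k (fun y : ℝ => φ (y : AddCircle P)) P) x
    rw [← e] at this
    exact this.symm
  obtain ⟨z, hz⟩ := (AddCircle.equivIco P 0).symm.surjective (y : AddCircle P)
  have hz' : ((z : ℝ) : AddCircle P) = y := hz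
  rw [torusDeriv, ← hz', AddCircle.liftIco_coe_apply z.2]
  exact (hper.lift_coe z).symm.trans ((congrArg hper.lift hz').trans (hper.lift_coe y))

theorem torusDeriv_succ (k : ℕ) (φ : AddCircle P → ℝ) :
    torusDeriv (k + 1) φ = torusDeriv 1 (torusDeriv k φ) := by
  funext x
  induction x using QuotientAddGroup.induction_on with
  | H y =>
    rw [torusDeriv_coe, torusDeriv_coe, iteratedDeriv_succ, iteratedDeriv_one]
    congr 1
    funext y
    rw [torusDeriv_coe]

theorem torusDeriv_zero (φ : AddCircle P → ℝ) : torusDeriv 0 φ = φ := by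
  funext x
  induction x using QuotientAddGroup.induction_on with
  | H y =>
    rw [torusDeriv_coe, iteratedDeriv_zero]

theorem SmoothTorus.torusDeriv {φ : AddCircle P → ℝ} (h : SmoothTorus φ) (k : ℕ) :
    SmoothTorus (torusDeriv k φ) := by
  unfold SmoothTorus
  simp only [torusDeriv_coe, iteratedDeriv_eq_iterate]
  exact ContDiff.iterate_deriv k h

/-- Integration by parts against a Hartley function. -/
theorem integral_torusDeriv_one_mul_hartley {φ : AddCircle P → ℝ} (h : SmoothTorus φ) (n : ℤ) :
    ∫ x, torusDeriv 1 φ x * hartley P n x =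
      -waveNumber P n * ∫ x, φ x * hartley P (-n) x := by
  have hd (y : ℝ) : HasDerivAt (fun y : ℝ => φ (y : AddCircle P))
      (torusDeriv 1 φ (y : AddCircle P)) y := by
    rw [torusDeriv_coe, iteratedDeriv_one]
    exact ((ContDiff.differentiable h (by simp)) y).hasDerivAt
  have c1 : Continuous fun y : ℝ => torusDeriv 1 φ (y : AddCircle P) :=
    (h.continuous_torusDeriv 1).comp (AddCircle.continuous_mk' P)
  have c2 : Continuous fun y : ℝ => waveNumber P n * hartley P (-n) (y : AddCircle P) :=
    continuous_const.mul ((continuous_hartley (-n)).comp (AddCircle.continuous_mk' P))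
  have key := intervalIntegral.integral_mul_deriv_eq_deriv_mul (a := 0) (b := 0 + P)
    (fun y _ => hasDerivAt_hartley n y) (fun y _ => hd y) (c2.intervalIntegrable _ _)
    (c1.intervalIntegrable _ _)
  have e0 : ((0 + P : ℝ) : AddCircle P) = ((0 : ℝ) : AddCircle P) := by simp
  rw [e0, sub_self, zero_sub] at key
  rw [← AddCircle.intervalIntegral_preimage P 0, ← AddCircle.intervalIntegral_preimage P 0]
  calc _ = ∫ y in (0 : ℝ)..(0 + P), hartley P n (y : AddCircle P) *
          torusDeriv 1 φ (y : AddCircle P) := by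
        refine intervalIntegral.integral_congr fun y _ => ?_
        simp only [mul_comm]
    _ = -∫ y in (0 : ℝ)..(0 + P), waveNumber P n * hartley P (-n) (y : AddCircle P) *
          φ (y : AddCircle P) := key
    _ = _ := by
        rw [neg_mul, ← intervalIntegral.integral_const_mul]
        congr 1
        refine intervalIntegral.integral_congr fun y _ => ?_
        ring

theorem coeff_torusDeriv {φ : AddCircle P → ℝ} (h : SmoothTorus φ) (k : ℕ) :
    (fun n => coeff P n (toL2 _ (h.continuous_torusDeriv k))) =
      (coeffDeriv P)^[k] fun n => coeff P n (toL2 φ h.continuous) := by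
  induction k with
  | zero =>
    simp only [coeff_toL2, torusDeriv_zero, Function.iterate_zero, id]
  | succ k ih =>
    rw [Function.iterate_succ_apply', ← ih]
    funext n
    simp only [coeffDeriv, coeff_toL2]
    rw [torusDeriv_succ, integral_torusDeriv_one_mul_hartley (h.torusDeriv k)]

/-- Weak derivatives are derivatives of the Hartley coefficients. -/
theorem isWeakDerivTorus_iff (k : ℕ) (f g : L2Torus P) :
    IsWeakDerivTorus k f g ↔
      ∀ n, coeff P n g = (coeffDeriv P)^[k] (fun m => coeff P m f) n := by
  have key {φ : AddCircle P → ℝ} (h : SmoothTorus φ) :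
      ∫ x, f x * torusDeriv k φ x = (-1) ^ k *
        ∑' n, (coeffDeriv P)^[k] (fun m => coeff P m f) n * coeff P n (toL2 φ h.continuous) := by
    rw [integral_mul_eq_inner f (h.continuous_torusDeriv k), ← tsum_coeff_mul_coeff,
      ← tsum_mul_coeffDeriv_iterate, ← coeff_torusDeriv h]
  constructor
  · intro hw n
    have h1 := hw _ (smoothTorus_hartley n)
    have h2 (m : ℤ) : coeff P m (toL2 (hartley P n) (smoothTorus_hartley n).continuous) =
        if m = n then 1 else 0 := isCoordSystem_L2Torus.dual m n
    rw [key (smoothTorus_hartley n), integral_mul_eq_inner g (smoothTorus_hartley n).continuous]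
      at h1
    have h3 := mul_left_cancel₀ (pow_ne_zero k (by norm_num : (-1 : ℝ) ≠ 0)) h1
    simp only [h2, mul_ite, mul_one, mul_zero, tsum_ite_eq] at h3
    rw [h3, coeff_apply, real_inner_comm]
    rfl
  · intro hc φ hφ
    rw [key hφ, integral_mul_eq_inner g hφ.continuous, ← tsum_coeff_mul_coeff]
    simp only [hc]

end Torus

section Torus

variable {P : ℝ} [hP : Fact (0 < P)]

/-! ### Sobolev spaces in Hartley coefficients -/

/-- The `n`-th Hartley coefficient on `H^m`. -/
noncomputable def sobolevCoeff (P : ℝ) [Fact (0 < P)] (m : ℕ) (n : ℤ) : HTorus P m →L[ℝ] ℝ :=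
  (coeff P n).comp (dx 0)

theorem coeff_dx {m : ℕ} (k : Fin (m + 1)) (g : HTorus P m) (n : ℤ) :
    coeff P n (dx k g) = (coeffDeriv P)^[k] (fun j => sobolevCoeff P m j g) n :=
  (isWeakDerivTorus_iff k _ _).1 (g.2 k) n

theorem coeff_dx_zero {m : ℕ} (g : HTorus P m) (n : ℤ) :
    coeff P n (dx 0 g) = sobolevCoeff P m n g := rfl

theorem coeff_dx_two (g : HTorus P 2) (n : ℤ) :
    coeff P n (dx 2 g) = -freq P n * sobolevCoeff P 2 n g := by
  rw [coeff_dx]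
  simp [coeffDeriv, waveNumber_neg, freq]
  ring

theorem coeff_dx_four (g : HTorus P 4) (n : ℤ) :
    coeff P n (dx 4 g) = freq P n ^ 2 * sobolevCoeff P 4 n g := by
  rw [coeff_dx]
  have : ((4 : Fin (4 + 1)) : ℕ) = 4 := rfl
  simp only [this, Function.iterate_succ, Function.iterate_zero, Function.comp_apply, id,
    coeffDeriv, waveNumber_neg, freq, neg_neg]
  ring

/-- A Hartley function as an element of `H^m`. -/
noncomputable def hartleySobolev (P : ℝ) [Fact (0 < P)] (m : ℕ) (n : ℤ) : HTorus P m :=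
  ⟨WithLp.toLp 2 fun k : Fin (m + 1) =>
      toL2 _ ((smoothTorus_hartley (P := P) n).continuous_torusDeriv k), fun k => by
    rw [isWeakDerivTorus_iff]
    intro j
    have := congrFun (coeff_torusDeriv (smoothTorus_hartley (P := P) n) k) j
    simp only [this, Fin.coe_ofNat_eq_mod, Nat.zero_mod, torusDeriv_zero]⟩

/-- In Hartley coefficients, `‖g‖²` in `H^m` is `∑_n (1 + μ_n + ⋯ + μ_n^m) |g_n|²`. -/
theorem isCoordSystem_HTorus (m : ℕ) :
    IsCoordSystem (sobolevCoeff P m) (fun n => sobolevWeight m (freq P n))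
      (hartleySobolev P m) where
  pos n := one_pos.trans_le (one_le_sobolevWeight m (freq_nonneg n))
  hasSum g := by
    have h1 : ‖g‖ ^ 2 = ∑ k : Fin (m + 1), ‖dx k g‖ ^ 2 := PiLp.norm_sq_eq_of_L2 _ g.1
    rw [h1]
    have h2 (k : Fin (m + 1)) :
        HasSum (fun n => freq P n ^ (k : ℕ) * sobolevCoeff P m n g ^ 2) (‖dx k g‖ ^ 2) := by
      have h3 := isCoordSystem_L2Torus.hasSum (dx k g)
      simp only [coeff_dx] at h3
      have h4 := hasSum_of_coeffDeriv_iterate (k : ℕ) (w := fun _ => (1 : ℝ)) (fun _ => rfl) h3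
      simpa using h4
    refine (hasSum_sum fun k _ => h2 k).congr_fun fun n => ?_
    rw [sobolevWeight, Finset.sum_mul, Finset.sum_range]
  dual n j := by
    have h1 : dx 0 (hartleySobolev P m j) = hartleyL2 P j := by
      change toL2 _ ((smoothTorus_hartley (P := P) j).continuous_torusDeriv 0) = hartleyL2 P j
      simp only [torusDeriv_zero]
      rfl
    rw [← coeff_dx_zero, h1]
    exact isCoordSystem_L2Torus.dual n j

end Torus

/-! ### Multiplication by a bounded function of space and time -/

section Multiplication

variable {P : ℝ} [hP : Fact (0 < P)] {T : ℝ}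

theorem ae_ae_of_ae_prod_swap {Q : AddCircle P × ℝ → Prop} {ν : Measure ℝ} [SFinite ν]
    (h : ∀ᵐ p ∂((volume : Measure (AddCircle P)).prod ν), Q p) :
    ∀ᵐ t ∂ν, ∀ᵐ x ∂(volume : Measure (AddCircle P)), Q (x, t) :=
  Measure.ae_ae_of_ae_prod (Measure.measurePreserving_swap.quasiMeasurePreserving.ae h)

theorem memLp_mul_of_bound {g : AddCircle P → ℝ} (hg : StronglyMeasurable g) {M : ℝ}
    (hM : ∀ x, ‖g x‖ ≤ M) {f : AddCircle P → ℝ} (hf : MemLp f 2 volume) :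
    MemLp (fun x => g x * f x) 2 volume :=
  hf.of_le_mul (c := M) (hg.aestronglyMeasurable.mul hf.aestronglyMeasurable)
    (Filter.Eventually.of_forall fun x => by
      rw [norm_mul]; exact mul_le_mul_of_nonneg_right (hM x) (norm_nonneg _))

/-- The product of an element of `L²(0,T;L²)` with a bounded measurable function of `(x,t)` is an
element of `L²(0,T;L²)`. Its strong measurability in time is checked on Hartley coefficients, by
Fubini's theorem. -/
theorem exists_mul {a : AddCircle P × ℝ → ℝ} {M : ℝ} (hM0 : 0 ≤ M)
    (ha : AEStronglyMeasurable a (volume.prod (volume.restrict (Ioo 0 T))))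
    (hM : ∀ᵐ p ∂(volume.prod (volume.restrict (Ioo 0 T))), ‖a p‖ ≤ M)
    (u : L2Time T (L2Torus P)) :
    ∃ F : L2Time T (L2Torus P), ∀ᵐ t ∂(volume.restrict (Ioo 0 T)),
      ∀ᵐ x ∂(volume : Measure (AddCircle P)), F t x = a (x, t) * u t x := by
  -- A strongly measurable version of `a` that is bounded by `M` everywhere.
  let b : AddCircle P × ℝ → ℝ := fun p => max (-M) (min M (ha.mk a p))
  have hb : StronglyMeasurable b :=
    stronglyMeasurable_const.sup (stronglyMeasurable_const.inf ha.stronglyMeasurable_mk)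
  have hbM (p : AddCircle P × ℝ) : ‖b p‖ ≤ M := by
    rw [Real.norm_eq_abs, abs_le]
    exact ⟨le_max_left _ _, max_le (by linarith) (min_le_left _ _)⟩
  have hab : ∀ᵐ p ∂(volume.prod (volume.restrict (Ioo 0 T))), b p = a p := by
    filter_upwards [ha.ae_eq_mk, hM] with p h1 h2
    rw [Real.norm_eq_abs, abs_le] at h2
    simp only [b, ← h1]
    rw [min_eq_right h2.2, max_eq_right h2.1]
  have hbt (t : ℝ) : StronglyMeasurable fun x => b (x, t) :=
    hb.comp_measurable measurable_prodMk_right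
  have hF (t : ℝ) : MemLp (fun x => b (x, t) * u t x) 2 volume :=
    memLp_mul_of_bound (hbt t) (fun x => hbM _) (Lp.memLp _)
  have hG (n : ℤ) (t : ℝ) : MemLp (fun x => b (x, t) * hartley P n x) 2 volume :=
    memLp_mul_of_bound (hbt t) (fun x => hbM _) (memLp_of_continuous (continuous_hartley n))
  let F : ℝ → L2Torus P := fun t => (hF t).toLp
  let G (n : ℤ) : ℝ → L2Torus P := fun t => (hG n t).toLp
  have hGm (n : ℤ) : AEStronglyMeasurable (G n) (volume.restrict (Ioo 0 T)) := by
    refine isCoordSystem_L2Torus.aestronglyMeasurable fun m => ?_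
    have e (t : ℝ) : coeff P m (G n t) =
        ∫ x, (b (x, t) * hartley P n x) * hartley P m x := by
      rw [coeff_apply, real_inner_comm, hartleyL2, ← integral_mul_eq_inner]
      refine integral_congr_ae ?_
      filter_upwards [(hG n t).coeFn_toLp] with x hx
      rw [hx]
    simp only [e]
    refine StronglyMeasurable.aestronglyMeasurable ?_
    have hs : StronglyMeasurable fun p : AddCircle P × ℝ =>
        (b p * hartley P n p.1) * hartley P m p.1 :=
      (hb.mul ((continuous_hartley n).comp continuous_fst).stronglyMeasurable).mul
        ((continuous_hartley m).comp continuous_fst).stronglyMeasurable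
    exact hs.integral_prod_left'
  have hFm : AEStronglyMeasurable F (volume.restrict (Ioo 0 T)) := by
    refine isCoordSystem_L2Torus.aestronglyMeasurable fun n => ?_
    have e (t : ℝ) : coeff P n (F t) = inner ℝ (G n t) (u t) := by
      rw [coeff_apply, L2.inner_def, L2.inner_def]
      refine integral_congr_ae ?_
      filter_upwards [(hG n t).coeFn_toLp, (hF t).coeFn_toLp,
        coeFn_toL2 (continuous_hartley (P := P) n)] with x h1 h2 h3
      rw [h1, h2, hartleyL2, h3]
      simp only [RCLike.inner_apply, conj_trivial]
      ring
    simp only [e]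
    exact (hGm n).inner (Lp.aestronglyMeasurable u)
  have hFn (t : ℝ) : ‖F t‖ ≤ M * ‖u t‖ := by
    refine Lp.norm_le_mul_norm_of_ae_le_mul ?_
    filter_upwards [(hF t).coeFn_toLp] with x hx
    rw [hx, norm_mul]
    exact mul_le_mul_of_nonneg_right (hbM _) (norm_nonneg _)
  have hFL : MemLp F 2 (volume.restrict (Ioo 0 T)) :=
    (Lp.memLp u).of_le_mul hFm (Filter.Eventually.of_forall hFn)
  refine ⟨hFL.toLp, ?_⟩
  filter_upwards [hFL.coeFn_toLp, ae_ae_of_ae_prod_swap hab] with t h1 h2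
  rw [h1]
  filter_upwards [h2, (hF t).coeFn_toLp] with x h3 h4
  rw [h4, h3]

theorem norm_le_of_ae_eq_mul {g : AddCircle P → ℝ} {M : ℝ} {F u : L2Torus P}
    (hg : ∀ᵐ x, ‖g x‖ ≤ M) (h : ∀ᵐ x, F x = g x * u x) : ‖F‖ ≤ M * ‖u‖ := by
  refine Lp.norm_le_mul_norm_of_ae_le_mul ?_
  filter_upwards [hg, h] with x h1 h2
  rw [h2, norm_mul]
  exact mul_le_mul_of_nonneg_right h1 (norm_nonneg _)

end Multiplication

/-! ### Weak time derivatives in coordinates -/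

section WeakDeriv

variable {T : ℝ} {X : Type} [NormedAddCommGroup X] [NormedSpace ℝ X] [CompleteSpace X]

theorem integral_smul_compLpL {Y : Type} [NormedAddCommGroup Y] [NormedSpace ℝ Y]
    [CompleteSpace Y] (L : X →L[ℝ] Y) {φ : ℝ → ℝ} (hφ : Continuous φ) (u : L2Time T X) :
    ∫ t in Ioo 0 T, φ t • L.compLpL 2 (volume.restrict (Ioo 0 T)) u t =
      L (∫ t in Ioo 0 T, φ t • u t) := by
  rw [← L.integral_comp_comm (integrable_test_smul hφ u)]
  refine integral_congr_ae ?_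
  filter_upwards [ContinuousLinearMap.coeFn_compLpL L u] with t ht
  rw [ht, map_smul]

theorem IsWeakDerivTime.map {Y : Type} [NormedAddCommGroup Y] [NormedSpace ℝ Y]
    [CompleteSpace Y] (L : X →L[ℝ] Y) {k : ℕ} {u v : L2Time T X} (h : IsWeakDerivTime k u v) :
    IsWeakDerivTime k (L.compLpL 2 (volume.restrict (Ioo 0 T)) u)
      (L.compLpL 2 (volume.restrict (Ioo 0 T)) v) := by
  intro φ h1 h2 h3
  rw [integral_smul_compLpL L (h1.continuous_iteratedDeriv k (by exact_mod_cast le_top)),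
    integral_smul_compLpL L h1.continuous, h φ h1 h2 h3, map_smul]

theorem IsCoordSystem.isWeakDerivTime {ℓ : ℤ → X →L[ℝ] ℝ} {r : ℤ → ℝ} {e : ℤ → X}
    (hℓ : IsCoordSystem ℓ r e) {k : ℕ} {u v : L2Time T X}
    (h : ∀ n, IsWeakDerivTime k (timeCoord (ℓ n) u) (timeCoord (ℓ n) v)) :
    IsWeakDerivTime k u v := by
  intro φ h1 h2 h3
  refine hℓ.ext fun n => ?_
  rw [map_smul, ← integral_smul_compLpL (ℓ n)
    (h1.continuous_iteratedDeriv k (by exact_mod_cast le_top)),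
    ← integral_smul_compLpL (ℓ n) h1.continuous]
  exact h n φ h1 h2 h3

theorem IsWeakDerivTime.unique {k : ℕ} {u v v' : L2Time T X} (h : IsWeakDerivTime k u v)
    (h' : IsWeakDerivTime k u v') : v = v' := by
  have hloc : LocallyIntegrableOn (fun t => v t - v' t) (Ioo 0 T) volume :=
    IntegrableOn.locallyIntegrableOn (v.integrable.sub v'.integrable)
  have main := isOpen_Ioo.ae_eq_zero_of_integral_contDiff_smul_eq_zero hloc
    fun φ h1 h2 h3 => by
      have e1 : ∫ t, φ t • (v t - v' t) = ∫ t in Ioo 0 T, φ t • (v t - v' t) :=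
        (setIntegral_eq_integral_of_forall_compl_eq_zero fun x hx => by
          rw [image_eq_zero_of_notMem_tsupport fun h => hx (h3 h), zero_smul]).symm
      have e2 : ∫ t in Ioo 0 T, φ t • (v t - v' t) =
          (∫ t in Ioo 0 T, φ t • v t) - ∫ t in Ioo 0 T, φ t • v' t := by
        rw [← integral_sub (integrable_test_smul h1.continuous v)
          (integrable_test_smul h1.continuous v')]
        simp only [smul_sub]
      have e3 := (h φ h1 h2 h3).symm.trans (h' φ h1 h2 h3)
      have e4 : ∫ t in Ioo 0 T, φ t • v t = ∫ t in Ioo 0 T, φ t • v' t :=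
        smul_right_injective X (pow_ne_zero k (by norm_num : (-1 : ℝ) ≠ 0)) e3
      rw [e1, e2, e4, sub_self]
  refine Lp.ext ?_
  rw [Filter.EventuallyEq, ae_restrict_iff' measurableSet_Ioo]
  filter_upwards [main] with t ht ht'
  exact sub_eq_zero.1 (ht ht')

theorem isWeakDerivTime_zero (u : L2Time T X) : IsWeakDerivTime 0 u u := by
  intro φ _ _ _
  simp

/-- A weak second derivative is a weak derivative of a weak first derivative. -/
theorem IsWeakDerivTime.one_of_two {u v w : L2Time T X} (h : IsWeakDerivTime 1 u v)
    (h' : IsWeakDerivTime 2 u w) : IsWeakDerivTime 1 v w := by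
  intro φ h1 h2 h3
  have hd : ContDiff ℝ ∞ (deriv φ) := h1.iterate_deriv 1
  have h4 := h (deriv φ) hd h2.deriv (tsupport_deriv_subset.trans h3)
  have h5 := h' φ h1 h2 h3
  have e : iteratedDeriv 1 (deriv φ) = iteratedDeriv 2 φ := by
    rw [iteratedDeriv_one, iteratedDeriv_succ, iteratedDeriv_one]
  rw [e, h5, even_two.neg_one_pow, one_smul, pow_one, neg_one_smul] at h4
  rw [iteratedDeriv_one, pow_one, neg_one_smul, h4, neg_neg]

/-- Weak first derivatives compose. -/
theorem IsWeakDerivTime.two_of_one {u v w : L2Time T X} (h : IsWeakDerivTime 1 u v)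
    (h' : IsWeakDerivTime 1 v w) : IsWeakDerivTime 2 u w := by
  intro φ h1 h2 h3
  have hd : ContDiff ℝ ∞ (deriv φ) := h1.iterate_deriv 1
  have h4 := h (deriv φ) hd h2.deriv (tsupport_deriv_subset.trans h3)
  have h5 := h' φ h1 h2 h3
  have e : iteratedDeriv 1 (deriv φ) = iteratedDeriv 2 φ := by
    rw [iteratedDeriv_one, iteratedDeriv_succ, iteratedDeriv_one]
  rw [iteratedDeriv_one] at h5
  rw [e, h5, pow_one, neg_one_smul, neg_one_smul, neg_neg] at h4
  rw [h4, even_two.neg_one_pow, one_smul]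

/-- An absolutely continuous function has a weak derivative. -/
theorem isWeakDerivTime_of_isPrimitive (hT : 0 < T) {y z : ℝ → ℝ} (h : IsPrimitive T y z)
    {u v : L2Time T ℝ} (hu : u =ᵐ[volume.restrict (Ioo 0 T)] y)
    (hv : v =ᵐ[volume.restrict (Ioo 0 T)] z) : IsWeakDerivTime 1 u v := by
  intro φ h1 _ h3
  have key := integral_deriv_mul_of_isPrimitive hT h h1 h3
  have e1 : ∫ t in Ioo 0 T, iteratedDeriv 1 φ t • u t = ∫ t in Ioo 0 T, deriv φ t * y t := by
    refine integral_congr_ae ?_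
    filter_upwards [hu] with t ht
    rw [ht, iteratedDeriv_one, smul_eq_mul]
  have e2 : ∫ t in Ioo 0 T, φ t • v t = ∫ t in Ioo 0 T, φ t * z t := by
    refine integral_congr_ae ?_
    filter_upwards [hv] with t ht
    rw [ht, smul_eq_mul]
  rw [e1, e2, key, pow_one, neg_one_smul]

/-- A function with a weak derivative that attains the initial value `b` is the primitive of its
weak derivative starting from `b`. -/
theorem ae_eq_primitive_of_hasInitialValue (hT : 0 < T) {u v : L2Time T X}
    (h : IsWeakDerivTime 1 u v) {b : X} (hb : HasInitialValue u b) (ℓ : X →L[ℝ] ℝ) :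
    timeCoord ℓ u =ᵐ[volume.restrict (Ioo 0 T)]
      fun t => ℓ b + ∫ s in (0 : ℝ)..t, timeCoord ℓ v s := by
  obtain ⟨w, hw, huw, rfl⟩ := hb
  refine ae_eq_primitive_of_weakDeriv (w := fun t => ℓ (w t)) hT (timeCoord ℓ u).integrable
    (timeCoord ℓ v).integrable (fun φ h1 h2 h3 => ?_) (ℓ.continuous.comp_continuousOn hw) ?_
  · have := h.map ℓ φ h1 h2 h3
    rwa [iteratedDeriv_one, pow_one, neg_one_smul] at this
  · filter_upwards [coeFn_timeCoord ℓ u, huw] with t e1 e2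
    rw [e1, e2]

/-- Conversely, a function whose coordinates are primitives starting from those of `b` attains the
initial value `b`. -/
theorem IsCoordSystem.hasInitialValue (hT : 0 < T) {ℓ : ℤ → X →L[ℝ] ℝ} {r : ℤ → ℝ} {e : ℤ → X}
    (hℓ : IsCoordSystem ℓ r e) {u v : L2Time T X} {b : X}
    (h : ∀ n, timeCoord (ℓ n) u =ᵐ[volume.restrict (Ioo 0 T)]
      fun t => ℓ n b + ∫ s in (0 : ℝ)..t, timeCoord (ℓ n) v s) : HasInitialValue u b := by
  have hi : IntervalIntegrable v volume 0 T := by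
    rw [intervalIntegrable_iff_integrableOn_Ioo_of_le hT.le]
    exact v.integrable
  refine ⟨fun t => b + ∫ s in (0 : ℝ)..t, v s, ?_, ?_, by simp⟩
  · have := intervalIntegral.continuousOn_primitive_interval' hi left_mem_uIcc
    rw [uIcc_of_le hT.le] at this
    exact continuousOn_const.add this
  · have h1 : ∀ᵐ t ∂(volume.restrict (Ioo 0 T)), ∀ n, ℓ n (u t) =
        ℓ n b + ∫ s in (0 : ℝ)..t, timeCoord (ℓ n) v s := by
      rw [ae_all_iff]
      intro n
      exact (coeFn_timeCoord (ℓ n) u).symm.trans (h n)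
    filter_upwards [h1, ae_restrict_mem measurableSet_Ioo] with t ht htT
    refine hℓ.ext fun n => ?_
    have hit : IntervalIntegrable v volume 0 t := hi.mono_set (by
      rw [uIcc_of_le htT.1.le, uIcc_of_le hT.le]; exact Icc_subset_Icc_right htT.2.le)
    rw [ht n, map_add, ← (ℓ n).intervalIntegral_comp_comm hit]
    congr 1
    refine intervalIntegral.integral_congr_ae ?_
    have h2 := coeFn_timeCoord (ℓ n) v
    have h3 : ∀ᵐ s ∂(volume.restrict (Ioc 0 T)), timeCoord (ℓ n) v s = ℓ n (v s) := by
      rwa [← restrict_Ioo_eq_restrict_Ioc]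
    rw [ae_restrict_iff' measurableSet_Ioc] at h3
    filter_upwards [h3] with s hs hs'
    rw [uIoc_of_le htT.1.le] at hs'
    exact hs ⟨hs'.1, hs'.2.trans htT.2.le⟩

end WeakDeriv

/-! ### The damped beam equation with a source -/

section Forced

variable {P : ℝ} [hP : Fact (0 < P)] {T : ℝ}

/-- `β` solves `∂_tt β - ∂_txx β + ∂_xxxx β = f` with the initial values `β₀`, `β₁`. -/
structure IsForcedSolution (f : L2Time T (L2Torus P)) (β₀ : HTorus P 3) (β₁ : HTorus P 1)
    (β : beamSpace P T) : Prop where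
  equation : ∀ᵐ t ∂(volume.restrict (Ioo 0 T)),
    dt 2 (inH2L2 β) t - dx 2 (dt 1 (inH1H2 β) t) + dx 4 (inL2H4 β t) = f t
  initial_displacement : HasInitialValue (dt 0 (inH2L2 β)) (dx 0 β₀)
  initial_velocity : HasInitialValue (dt 1 (inH2L2 β)) (dx 0 β₁)

theorem timeCoord_inclL2 {m : ℕ} (u : L2Time T (HTorus P m)) (n : ℤ) :
    timeCoord (coeff P n) (inclL2 u) = timeCoord (sobolevCoeff P m n) u := by
  refine Lp.ext ?_
  have h := ContinuousLinearMap.coeFn_compLpL (p := 2) (μ := volume.restrict (Ioo 0 T))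
    (dx (P := P) (m := m) 0) u
  filter_upwards [coeFn_timeCoord (coeff P n) (inclL2 u), coeFn_timeCoord (sobolevCoeff P m n) u,
    h] with t h1 h2 h3
  rw [h1, h2, ← coeff_dx_zero, inclL2, h3]

section BeamSpace

variable (β : beamSpace P T) (n : ℤ)

theorem isWeakDerivTime_H1H2 : IsWeakDerivTime 1 (dt 0 (inH1H2 β)) (dt 1 (inH1H2 β)) :=
  (inH1H2 β).2 1

theorem isWeakDerivTime_H2L2_one : IsWeakDerivTime 1 (dt 0 (inH2L2 β)) (dt 1 (inH2L2 β)) :=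
  (inH2L2 β).2 1

theorem isWeakDerivTime_H2L2_two : IsWeakDerivTime 2 (dt 0 (inH2L2 β)) (dt 2 (inH2L2 β)) :=
  (inH2L2 β).2 2

theorem timeCoord_inL2H4 :
    timeCoord (sobolevCoeff P 4 n) (inL2H4 β) = timeCoord (coeff P n) (dt 0 (inH2L2 β)) := by
  rw [← timeCoord_inclL2]
  exact congrArg _ β.2.1

theorem timeCoord_inH1H2_zero :
    timeCoord (sobolevCoeff P 2 n) (dt 0 (inH1H2 β)) =
      timeCoord (coeff P n) (dt 0 (inH2L2 β)) := by
  rw [← timeCoord_inclL2]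
  exact congrArg _ β.2.2

theorem timeCoord_inH1H2_one :
    timeCoord (sobolevCoeff P 2 n) (dt 1 (inH1H2 β)) =
      timeCoord (coeff P n) (dt 1 (inH2L2 β)) := by
  have h1 := (isWeakDerivTime_H1H2 β).map (sobolevCoeff P 2 n)
  have h2 := (isWeakDerivTime_H2L2_one β).map (coeff P n)
  have h3 := timeCoord_inH1H2_zero β n
  rw [timeCoord, timeCoord] at h3
  rw [h3] at h1
  exact h1.unique h2

end BeamSpace

/-- An element of the beam space is determined by the underlying element of `L²(0,T;L²)`. -/
theorem beamSpace_ext {β β' : beamSpace P T} (h : dt 0 (inH2L2 β) = dt 0 (inH2L2 β')) :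
    β = β' := by
  have h1 : inL2H4 β = inL2H4 β' := (isCoordSystem_HTorus 4).time_ext fun n => by
    rw [timeCoord_inL2H4, timeCoord_inL2H4, h]
  have h2 : dt 0 (inH1H2 β) = dt 0 (inH1H2 β') := (isCoordSystem_HTorus 2).time_ext fun n => by
    rw [timeCoord_inH1H2_zero, timeCoord_inH1H2_zero, h]
  have h3 : dt 1 (inH1H2 β) = dt 1 (inH1H2 β') := by
    have := isWeakDerivTime_H1H2 β
    rw [h2] at this
    exact this.unique (isWeakDerivTime_H1H2 β')
  have h4 : dt 1 (inH2L2 β) = dt 1 (inH2L2 β') := by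
    have := isWeakDerivTime_H2L2_one β
    rw [h] at this
    exact this.unique (isWeakDerivTime_H2L2_one β')
  have h5 : dt 2 (inH2L2 β) = dt 2 (inH2L2 β') := by
    have := isWeakDerivTime_H2L2_two β
    rw [h] at this
    exact this.unique (isWeakDerivTime_H2L2_two β')
  refine Subtype.ext (Prod.ext h1 (Prod.ext ?_ ?_))
  · refine Subtype.ext (PiLp.ext fun k => ?_)
    fin_cases k
    · exact h2
    · exact h3
  · refine Subtype.ext (PiLp.ext fun k => ?_)
    fin_cases k
    · exact h
    · exact h4
    · exact h5

/-- The `n`-th Hartley coefficient of the left-hand side of the equation. -/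
theorem coeff_equation (β : beamSpace P T) (n : ℤ) :
    ∀ᵐ t ∂(volume.restrict (Ioo 0 T)),
      coeff P n (dt 2 (inH2L2 β) t - dx 2 (dt 1 (inH1H2 β) t) + dx 4 (inL2H4 β t)) =
        timeCoord (coeff P n) (dt 2 (inH2L2 β)) t +
          freq P n * timeCoord (coeff P n) (dt 1 (inH2L2 β)) t +
          freq P n ^ 2 * timeCoord (coeff P n) (dt 0 (inH2L2 β)) t := by
  rw [← timeCoord_inH1H2_one, ← timeCoord_inL2H4]
  filter_upwards [coeFn_timeCoord (coeff P n) (dt 2 (inH2L2 β)),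
    coeFn_timeCoord (sobolevCoeff P 2 n) (dt 1 (inH1H2 β)),
    coeFn_timeCoord (sobolevCoeff P 4 n) (inL2H4 β)] with t h1 h2 h3
  rw [map_add, map_sub, coeff_dx_two, coeff_dx_four, h1, h2, h3]
  ring

/-- The equation is equivalent to the equations of all its modes: here from the equation to the
modes, by the du Bois-Reymond lemma. -/
theorem IsForcedSolution.exists_isMode (hT : 0 < T) {f : L2Time T (L2Torus P)} {β₀ : HTorus P 3}
    {β₁ : HTorus P 1} {β : beamSpace P T} (h : IsForcedSolution f β₀ β₁ β) (n : ℤ) :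
    ∃ y z : ℝ → ℝ, IsMode T (freq P n) (sobolevCoeff P 3 n β₀) (sobolevCoeff P 1 n β₁)
        (timeCoord (coeff P n) f) y z (timeCoord (coeff P n) (dt 2 (inH2L2 β))) ∧
      timeCoord (coeff P n) (dt 0 (inH2L2 β)) =ᵐ[volume.restrict (Ioo 0 T)] y ∧
      timeCoord (coeff P n) (dt 1 (inH2L2 β)) =ᵐ[volume.restrict (Ioo 0 T)] z := by
  have w1 := isWeakDerivTime_H2L2_one β
  have hy := ae_eq_primitive_of_hasInitialValue hT w1 h.initial_displacement (coeff P n)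
  have hz := ae_eq_primitive_of_hasInitialValue hT
    (w1.one_of_two (isWeakDerivTime_H2L2_two β)) h.initial_velocity (coeff P n)
  rw [coeff_dx_zero] at hy hz
  refine ⟨_, _, ⟨?_, .of_integrableOn hT.le _ (L2Time.integrable _), ?_, ?_, Lp.memLp _, ?_⟩,
    hy, hz⟩
  · exact (IsPrimitive.of_integrableOn hT.le _ (L2Time.integrable _)).congr_deriv hT.le hz
  · simp
  · simp
  · filter_upwards [h.equation, coeff_equation β n, hy, hz, coeFn_timeCoord (coeff P n) f]
      with t h1 h2 h3 h4 h5
    rw [h5, ← h1, h2, h3, h4]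

/-- From the equations of the modes to the equation. -/
theorem isForcedSolution_of_isMode (hT : 0 < T) {f : L2Time T (L2Torus P)} {β₀ : HTorus P 3}
    {β₁ : HTorus P 1} {β : beamSpace P T}
    (h : ∀ n, ∃ y z : ℝ → ℝ, IsMode T (freq P n) (sobolevCoeff P 3 n β₀) (sobolevCoeff P 1 n β₁)
        (timeCoord (coeff P n) f) y z (timeCoord (coeff P n) (dt 2 (inH2L2 β))) ∧
      timeCoord (coeff P n) (dt 0 (inH2L2 β)) =ᵐ[volume.restrict (Ioo 0 T)] y ∧
      timeCoord (coeff P n) (dt 1 (inH2L2 β)) =ᵐ[volume.restrict (Ioo 0 T)] z) :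
    IsForcedSolution f β₀ β₁ β where
  equation := by
    have key : ∀ᵐ t ∂(volume.restrict (Ioo 0 T)), ∀ n,
        coeff P n (dt 2 (inH2L2 β) t - dx 2 (dt 1 (inH1H2 β) t) + dx 4 (inL2H4 β t)) =
          coeff P n (f t) := by
      rw [ae_all_iff]
      intro n
      obtain ⟨y, z, hm, hy, hz⟩ := h n
      filter_upwards [hm.equation, coeff_equation β n, hy, hz, coeFn_timeCoord (coeff P n) f]
        with t h1 h2 h3 h4 h5
      rw [h2, ← h5, ← h1, h3, h4]
    filter_upwards [key] with t ht
    exact isCoordSystem_L2Torus.ext ht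
  initial_displacement := by
    refine isCoordSystem_L2Torus.hasInitialValue hT (v := dt 1 (inH2L2 β)) fun n => ?_
    obtain ⟨y, z, hm, hy, hz⟩ := h n
    have hp := hm.primitive.congr_deriv hT.le hz.symm
    filter_upwards [hy, ae_restrict_mem measurableSet_Ioo] with t h1 h2
    rw [h1, hp.eq_integral t (Ioo_subset_Icc_self h2), hm.init, coeff_dx_zero]
  initial_velocity := by
    refine isCoordSystem_L2Torus.hasInitialValue hT (v := dt 2 (inH2L2 β)) fun n => ?_
    obtain ⟨y, z, hm, hy, hz⟩ := h n
    filter_upwards [hz, ae_restrict_mem measurableSet_Ioo] with t h1 h2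
    rw [h1, hm.primitive'.eq_integral t (Ioo_subset_Icc_self h2), hm.init', coeff_dx_zero]

theorem L2Time.norm_sq_of_ae_eq {u : L2Time T ℝ} {y : ℝ → ℝ}
    (h : u =ᵐ[volume.restrict (Ioo 0 T)] y) : ‖u‖ ^ 2 = ∫ t in Ioo 0 T, y t ^ 2 := by
  rw [L2Time.norm_sq_eq]
  refine integral_congr_ae ?_
  filter_upwards [h] with t ht
  rw [ht, Real.norm_eq_abs, sq_abs]

/-- The constant of the maximal regularity estimate. -/
noncomputable def regularityConst (T : ℝ) : ℝ := 25 + 5 * Real.exp (3 * T)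

theorem regularityConst_pos (T : ℝ) : 0 < regularityConst T := by
  rw [regularityConst]; positivity

/-- The energy of the data of a mode. -/
noncomputable def modeEnergy (f : L2Time T (L2Torus P)) (β₀ : HTorus P 3) (β₁ : HTorus P 1)
    (n : ℤ) : ℝ :=
  sobolevWeight 3 (freq P n) * sobolevCoeff P 3 n β₀ ^ 2 +
    sobolevWeight 1 (freq P n) * sobolevCoeff P 1 n β₁ ^ 2 + ‖timeCoord (coeff P n) f‖ ^ 2

theorem hasSum_modeEnergy (f : L2Time T (L2Torus P)) (β₀ : HTorus P 3) (β₁ : HTorus P 1) :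
    HasSum (modeEnergy f β₀ β₁) (‖β₀‖ ^ 2 + ‖β₁‖ ^ 2 + ‖f‖ ^ 2) := by
  have h1 := isCoordSystem_L2Torus.hasSum_time f
  simp only [one_mul] at h1
  exact (((isCoordSystem_HTorus 3).hasSum β₀).add ((isCoordSystem_HTorus 1).hasSum β₁)).add h1

/-- The estimates of `IsMode.estimate` for elements of `L²(0,T)`. -/
theorem IsMode.norm_estimate (hT : 0 < T) {f : L2Time T (L2Torus P)} {β₀ : HTorus P 3}
    {β₁ : HTorus P 1} {n : ℤ} {y z : ℝ → ℝ} {u₀ u₁ u₂ : L2Time T ℝ}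
    (h : IsMode T (freq P n) (sobolevCoeff P 3 n β₀) (sobolevCoeff P 1 n β₁)
      (timeCoord (coeff P n) f) y z u₂) (h0 : u₀ =ᵐ[volume.restrict (Ioo 0 T)] y)
    (h1 : u₁ =ᵐ[volume.restrict (Ioo 0 T)] z) :
    sobolevWeight 4 (freq P n) * ‖u₀‖ ^ 2 ≤ regularityConst T * modeEnergy f β₀ β₁ n ∧
      sobolevWeight 2 (freq P n) * ‖u₁‖ ^ 2 ≤ regularityConst T * modeEnergy f β₀ β₁ n ∧
      ‖u₂‖ ^ 2 ≤ regularityConst T * modeEnergy f β₀ β₁ n := by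
  have := h.estimate hT.le (freq_nonneg n) (C := regularityConst T)
    (R := modeEnergy f β₀ β₁ n) rfl (by
      rw [modeEnergy, L2Time.norm_sq_of_ae_eq (Filter.EventuallyEq.refl _ _)])
  rwa [L2Time.norm_sq_of_ae_eq h0, L2Time.norm_sq_of_ae_eq h1,
    L2Time.norm_sq_of_ae_eq (Filter.EventuallyEq.refl _ u₂)]

theorem sobolevWeight_mono {μ : ℝ} (hμ : 0 ≤ μ) {m k : ℕ} (h : m ≤ k) :
    sobolevWeight m μ ≤ sobolevWeight k μ :=
  Finset.sum_le_sum_of_subset_of_nonneg (Finset.range_mono (by omega))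
    fun _ _ _ => pow_nonneg hμ _

/-- Maximal regularity, summed over the modes. -/
theorem IsForcedSolution.beamNorm_le (hT : 0 < T) {f : L2Time T (L2Torus P)} {β₀ : HTorus P 3}
    {β₁ : HTorus P 1} {β : beamSpace P T} (h : IsForcedSolution f β₀ β₁ β) :
    beamNorm β ≤ 5 * √(regularityConst T * (‖β₀‖ ^ 2 + ‖β₁‖ ^ 2 + ‖f‖ ^ 2)) := by
  set R := regularityConst T * (‖β₀‖ ^ 2 + ‖β₁‖ ^ 2 + ‖f‖ ^ 2) with hR
  have hsum := (hasSum_modeEnergy f β₀ β₁).mul_left (regularityConst T)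
  have est (n : ℤ) : sobolevWeight 4 (freq P n) *
        ‖timeCoord (coeff P n) (dt 0 (inH2L2 β))‖ ^ 2 ≤
          regularityConst T * modeEnergy f β₀ β₁ n ∧
      sobolevWeight 2 (freq P n) * ‖timeCoord (coeff P n) (dt 1 (inH2L2 β))‖ ^ 2 ≤
        regularityConst T * modeEnergy f β₀ β₁ n ∧
      ‖timeCoord (coeff P n) (dt 2 (inH2L2 β))‖ ^ 2 ≤
        regularityConst T * modeEnergy f β₀ β₁ n := by
    obtain ⟨y, z, hm, hy, hz⟩ := h.exists_isMode hT n
    exact hm.norm_estimate hT hy hz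
  have n4 : ‖inL2H4 β‖ ^ 2 ≤ R := by
    refine hasSum_le (fun n => ?_) ((isCoordSystem_HTorus 4).hasSum_time (inL2H4 β)) hsum
    rw [timeCoord_inL2H4]; exact (est n).1
  have n20 : ‖dt 0 (inH1H2 β)‖ ^ 2 ≤ R := by
    refine hasSum_le (fun n => ?_) ((isCoordSystem_HTorus 2).hasSum_time (dt 0 (inH1H2 β))) hsum
    rw [timeCoord_inH1H2_zero]
    exact (mul_le_mul_of_nonneg_right (sobolevWeight_mono (freq_nonneg n) (by norm_num))
      (sq_nonneg _)).trans (est n).1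
  have n21 : ‖dt 1 (inH1H2 β)‖ ^ 2 ≤ R := by
    refine hasSum_le (fun n => ?_) ((isCoordSystem_HTorus 2).hasSum_time (dt 1 (inH1H2 β))) hsum
    rw [timeCoord_inH1H2_one]; exact (est n).2.1
  have n1 : ‖dt 1 (inH2L2 β)‖ ^ 2 ≤ R := by
    refine hasSum_le (fun n => ?_) (isCoordSystem_L2Torus.hasSum_time (dt 1 (inH2L2 β))) hsum
    exact (mul_le_mul_of_nonneg_right (one_le_sobolevWeight 2 (freq_nonneg n))
      (sq_nonneg _)).trans (est n).2.1
  have n2 : ‖dt 2 (inH2L2 β)‖ ^ 2 ≤ R := by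
    refine hasSum_le (fun n => ?_) (isCoordSystem_L2Torus.hasSum_time (dt 2 (inH2L2 β))) hsum
    rw [one_mul]; exact (est n).2.2
  have nH : ‖inH1H2 β‖ ^ 2 = ‖dt 0 (inH1H2 β)‖ ^ 2 + ‖dt 1 (inH1H2 β)‖ ^ 2 := by
    have := PiLp.norm_sq_eq_of_L2 _ (inH1H2 β).1
    rw [Fin.sum_univ_two] at this
    exact this
  have hR0 : 0 ≤ R := (sq_nonneg _).trans n4
  have s4 : ‖inL2H4 β‖ ≤ √R := Real.le_sqrt_of_sq_le n4
  have s21 : ‖dt 1 (inH1H2 β)‖ ≤ √R := Real.le_sqrt_of_sq_le n21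
  have two (x : ℝ) (hx : x ^ 2 ≤ 2 * R) : x ≤ 3 / 2 * √R := by
    refine abs_le_of_sq_le_sq' ?_ (by positivity) |>.2
    rw [mul_pow, Real.sq_sqrt hR0]
    linarith
  have sH := two _ (show ‖inH1H2 β‖ ^ 2 ≤ 2 * R by rw [nH]; linarith)
  have sL := two (√(‖dt 1 (inH2L2 β)‖ ^ 2 + ‖dt 2 (inH2L2 β)‖ ^ 2)) (by
    rw [Real.sq_sqrt (by positivity)]; linarith)
  rw [beamNorm]
  linarith

/-- The weighted energy estimate, summed over the modes. -/
theorem IsForcedSolution.weightedSq_le (hT : 0 < T) {f : L2Time T (L2Torus P)} {β₀ : HTorus P 3}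
    {β₁ : HTorus P 1} {β : beamSpace P T} (h : IsForcedSolution f β₀ β₁ β) {γ : ℝ}
    (hγ : 2 ≤ γ) :
    (γ - 2) * weightedSq γ (dt 0 (inH2L2 β)) ≤ ‖β₀‖ ^ 2 + ‖β₁‖ ^ 2 + weightedSq γ f := by
  have h1 := isCoordSystem_L2Torus.hasSum_weightedSq γ f
  have h2 := (isCoordSystem_L2Torus.hasSum_weightedSq γ (dt 0 (inH2L2 β))).mul_left (γ - 2)
  simp only [one_mul] at h1 h2
  refine hasSum_le (fun n => ?_) h2
    ((((isCoordSystem_HTorus 3).hasSum β₀).add ((isCoordSystem_HTorus 1).hasSum β₁)).add h1)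
  obtain ⟨y, z, hm, hy, hz⟩ := h.exists_isMode hT n
  have key := hm.weighted_energy hT.le (freq_nonneg n) hγ
  have e1 : weightedSq γ (timeCoord (coeff P n) (dt 0 (inH2L2 β))) ≤
      ∫ t in Ioo 0 T, Real.exp (-γ * t) * (y t ^ 2 + z t ^ 2) := by
    obtain ⟨cy, cz⟩ := hm.continuousOn hT.le
    refine integral_mono_ae (integrable_weight_mul γ (L2Time.integrable_norm_sq _))
      (integrable_weight_mul γ (integrable_of_continuousOn ((cy.pow 2).add (cz.pow 2)))) ?_
    filter_upwards [hy] with t ht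
    rw [ht, Real.norm_eq_abs, sq_abs]
    refine mul_le_mul_of_nonneg_left ?_ (Real.exp_pos _).le
    have := sq_nonneg (z t)
    linarith
  have e2 : weightedSq γ (timeCoord (coeff P n) f) =
      ∫ t in Ioo 0 T, Real.exp (-γ * t) * timeCoord (coeff P n) f t ^ 2 := by
    simp [weightedSq]
  rw [← e2] at key
  have e3 := mul_le_mul_of_nonneg_left e1 (show 0 ≤ γ - 2 by linarith)
  have hμ : 0 ≤ freq P n := freq_nonneg n
  have e4 : (1 + freq P n ^ 2) * sobolevCoeff P 3 n β₀ ^ 2 ≤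
      sobolevWeight 3 (freq P n) * sobolevCoeff P 3 n β₀ ^ 2 := by
    refine mul_le_mul_of_nonneg_right ?_ (sq_nonneg _)
    simp only [sobolevWeight, Finset.sum_range_succ, Finset.sum_range_zero]
    have := pow_nonneg hμ 3
    linarith
  have e5 : sobolevCoeff P 1 n β₁ ^ 2 ≤
      sobolevWeight 1 (freq P n) * sobolevCoeff P 1 n β₁ ^ 2 :=
    le_mul_of_one_le_left (sq_nonneg _) (one_le_sobolevWeight 1 hμ)
  linarith

/-- Every source in `L²(0,T;L²)` and all data in `H³ × H¹` have a solution: the modes are summed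
by the Riesz–Fischer theorem, and the estimates of the modes give the summability. -/
theorem exists_isForcedSolution (hT : 0 < T) (f : L2Time T (L2Torus P)) (β₀ : HTorus P 3)
    (β₁ : HTorus P 1) : ∃ β : beamSpace P T, IsForcedSolution f β₀ β₁ β := by
  choose y z w hm using fun n : ℤ => DampedBeam.exists_isMode hT (freq_nonneg (P := P) n)
    (sobolevCoeff P 3 n β₀) (sobolevCoeff P 1 n β₁) (timeCoord (coeff P n) f)
  have hyL (n : ℤ) : MemLp (y n) 2 (volume.restrict (Ioo 0 T)) :=
    memLp_of_continuousOn ((hm n).continuousOn hT.le).1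
  have hzL (n : ℤ) : MemLp (z n) 2 (volume.restrict (Ioo 0 T)) :=
    memLp_of_continuousOn ((hm n).continuousOn hT.le).2
  let Y (n : ℤ) : L2Time T ℝ := (hyL n).toLp
  let Z (n : ℤ) : L2Time T ℝ := (hzL n).toLp
  have hY (n : ℤ) : Y n =ᵐ[volume.restrict (Ioo 0 T)] y n := (hyL n).coeFn_toLp
  have hZ (n : ℤ) : Z n =ᵐ[volume.restrict (Ioo 0 T)] z n := (hzL n).coeFn_toLp
  have est (n : ℤ) := (hm n).norm_estimate hT (hY n) (hZ n)
  have hs : Summable fun n => regularityConst T * modeEnergy f β₀ β₁ n :=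
    (hasSum_modeEnergy f β₀ β₁).summable.mul_left _
  have wnn (m : ℕ) (n : ℤ) : 0 ≤ sobolevWeight m (freq P n) :=
    zero_le_one.trans (one_le_sobolevWeight m (freq_nonneg n))
  have sY4 : Summable fun n => sobolevWeight 4 (freq P n) * ‖Y n‖ ^ 2 :=
    hs.of_nonneg_of_le (fun n => mul_nonneg (wnn 4 n) (sq_nonneg _)) fun n => (est n).1
  have sY2 : Summable fun n => sobolevWeight 2 (freq P n) * ‖Y n‖ ^ 2 :=
    sY4.of_nonneg_of_le (fun n => mul_nonneg (wnn 2 n) (sq_nonneg _)) fun n =>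
      mul_le_mul_of_nonneg_right (sobolevWeight_mono (freq_nonneg n) (by norm_num)) (sq_nonneg _)
  have sY0 : Summable fun n => (1 : ℝ) * ‖Y n‖ ^ 2 :=
    sY4.of_nonneg_of_le (fun n => by positivity) fun n =>
      mul_le_mul_of_nonneg_right (one_le_sobolevWeight 4 (freq_nonneg n)) (sq_nonneg _)
  have sZ2 : Summable fun n => sobolevWeight 2 (freq P n) * ‖Z n‖ ^ 2 :=
    hs.of_nonneg_of_le (fun n => mul_nonneg (wnn 2 n) (sq_nonneg _)) fun n => (est n).2.1
  have sZ0 : Summable fun n => (1 : ℝ) * ‖Z n‖ ^ 2 :=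
    sZ2.of_nonneg_of_le (fun n => by positivity) fun n =>
      mul_le_mul_of_nonneg_right (one_le_sobolevWeight 2 (freq_nonneg n)) (sq_nonneg _)
  have sW : Summable fun n => (1 : ℝ) * ‖w n‖ ^ 2 :=
    hs.of_nonneg_of_le (fun n => by positivity) fun n => by rw [one_mul]; exact (est n).2.2
  obtain ⟨A, hA⟩ := (isCoordSystem_HTorus (P := P) 4).exists_timeCoord_eq Y sY4
  obtain ⟨B₀, hB₀⟩ := (isCoordSystem_HTorus (P := P) 2).exists_timeCoord_eq Y sY2
  obtain ⟨B₁, hB₁⟩ := (isCoordSystem_HTorus (P := P) 2).exists_timeCoord_eq Z sZ2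
  obtain ⟨C₀, hC₀⟩ := (isCoordSystem_L2Torus (P := P)).exists_timeCoord_eq Y sY0
  obtain ⟨C₁, hC₁⟩ := (isCoordSystem_L2Torus (P := P)).exists_timeCoord_eq Z sZ0
  obtain ⟨C₂, hC₂⟩ := (isCoordSystem_L2Torus (P := P)).exists_timeCoord_eq w sW
  have dYZ (n : ℤ) : IsWeakDerivTime 1 (Y n) (Z n) :=
    isWeakDerivTime_of_isPrimitive hT (hm n).primitive (hY n) (hZ n)
  have dZW (n : ℤ) : IsWeakDerivTime 1 (Z n) (w n) :=
    isWeakDerivTime_of_isPrimitive hT (hm n).primitive' (hZ n) (Filter.EventuallyEq.refl _ _)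
  have dB : IsWeakDerivTime 1 B₀ B₁ := (isCoordSystem_HTorus 2).isWeakDerivTime fun n => by
    rw [hB₀, hB₁]; exact dYZ n
  have dC1 : IsWeakDerivTime 1 C₀ C₁ := isCoordSystem_L2Torus.isWeakDerivTime fun n => by
    rw [hC₀, hC₁]; exact dYZ n
  have dC2 : IsWeakDerivTime 2 C₀ C₂ := isCoordSystem_L2Torus.isWeakDerivTime fun n => by
    rw [hC₀, hC₂]; exact (dYZ n).two_of_one (dZW n)
  let B : HTime T (HTorus P 2) 1 := ⟨WithLp.toLp 2 ![B₀, B₁], fun k => by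
    fin_cases k
    · exact isWeakDerivTime_zero B₀
    · exact dB⟩
  let C : HTime T (L2Torus P) 2 := ⟨WithLp.toLp 2 ![C₀, C₁, C₂], fun k => by
    fin_cases k
    · exact isWeakDerivTime_zero C₀
    · exact dC1
    · exact dC2⟩
  have c1 : inclL2 A = C₀ := isCoordSystem_L2Torus.time_ext fun n => by
    rw [timeCoord_inclL2, hA, hC₀]
  have c2 : inclL2 B₀ = C₀ := isCoordSystem_L2Torus.time_ext fun n => by
    rw [timeCoord_inclL2, hB₀, hC₀]
  let β : beamSpace P T := ⟨(A, B, C), c1, c2⟩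
  refine ⟨β, isForcedSolution_of_isMode hT fun n => ⟨y n, z n, ?_, ?_, ?_⟩⟩
  · change IsMode T _ _ _ _ (y n) (z n) (timeCoord (coeff P n) C₂)
    rw [hC₂]; exact hm n
  · change timeCoord (coeff P n) C₀ =ᵐ[_] _
    rw [hC₀]; exact hY n
  · change timeCoord (coeff P n) C₁ =ᵐ[_] _
    rw [hC₁]; exact hZ n

end Forced

/-! ### The potential as a perturbation -/

section Potential

variable {P : ℝ} [hP : Fact (0 < P)] {T : ℝ}

theorem weightedSq_nonneg {X : Type} [NormedAddCommGroup X] (γ : ℝ) (u : L2Time T X) :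
    0 ≤ weightedSq γ u := integral_nonneg fun _ => by positivity

theorem weightedSq_neg {X : Type} [NormedAddCommGroup X] (γ : ℝ) (u : L2Time T X) :
    weightedSq γ (-u) = weightedSq γ u := by
  refine integral_congr_ae ?_
  filter_upwards [Lp.coeFn_neg u] with t ht
  rw [ht, Pi.neg_apply, norm_neg]

theorem HasInitialValue.sub {X : Type} [NormedAddCommGroup X] {u v : L2Time T X} {x y : X}
    (hu : HasInitialValue u x) (hv : HasInitialValue v y) : HasInitialValue (u - v) (x - y) := by
  obtain ⟨w, h1, h2, rfl⟩ := hu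
  obtain ⟨w', h1', h2', rfl⟩ := hv
  refine ⟨fun t => w t - w' t, h1.sub h1', ?_, rfl⟩
  filter_upwards [Lp.coeFn_sub u v, h2, h2'] with t e1 e2 e3
  rw [e1, Pi.sub_apply, e2, e3]

/-- The difference of two solutions with the same data has zero data. -/
theorem IsForcedSolution.sub {f f' : L2Time T (L2Torus P)} {β₀ : HTorus P 3} {β₁ : HTorus P 1}
    {β β' : beamSpace P T} (h : IsForcedSolution f β₀ β₁ β) (h' : IsForcedSolution f' β₀ β₁ β') :
    IsForcedSolution (f - f') 0 0 (β - β') where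
  equation := by
    have e2 : dt 2 (inH2L2 (β - β')) = dt 2 (inH2L2 β) - dt 2 (inH2L2 β') := rfl
    have e1 : dt 1 (inH1H2 (β - β')) = dt 1 (inH1H2 β) - dt 1 (inH1H2 β') := rfl
    have e0 : inL2H4 (β - β') = inL2H4 β - inL2H4 β' := rfl
    rw [e2, e1, e0]
    filter_upwards [h.equation, h'.equation,
      Lp.coeFn_sub (dt 2 (inH2L2 β)) (dt 2 (inH2L2 β')),
      Lp.coeFn_sub (dt 1 (inH1H2 β)) (dt 1 (inH1H2 β')),
      Lp.coeFn_sub (inL2H4 β) (inL2H4 β'), Lp.coeFn_sub f f'] with t h1 h2 h3 h4 h5 h6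
    rw [h3, h4, h5, h6, Pi.sub_apply, Pi.sub_apply, Pi.sub_apply, Pi.sub_apply, ← h1, ← h2,
      map_sub, map_sub]
    abel
  initial_displacement := by
    have := h.initial_displacement.sub h'.initial_displacement
    rw [sub_self] at this
    rw [map_zero]
    exact this
  initial_velocity := by
    have := h.initial_velocity.sub h'.initial_velocity
    rw [sub_self] at this
    rw [map_zero]
    exact this

theorem dx_zero_inL2H4 (β : beamSpace P T) :
    ∀ᵐ t ∂(volume.restrict (Ioo 0 T)), dx 0 (inL2H4 β t) = dt 0 (inH2L2 β) t := by
  have h1 : inclL2 (inL2H4 β) = dt 0 (inH2L2 β) := β.2.1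
  rw [← h1]
  filter_upwards [ContinuousLinearMap.coeFn_compLpL (p := 2) (μ := volume.restrict (Ioo 0 T))
    (dx (P := P) (m := 4) 0) (inL2H4 β)] with t ht
  rw [inclL2, ht]

/-- `F` is the product of `u` with the function `a` of `(x,t)`. -/
def IsProduct (a : AddCircle P × ℝ → ℝ) (u F : L2Time T (L2Torus P)) : Prop :=
  ∀ᵐ t ∂(volume.restrict (Ioo 0 T)), ∀ᵐ x ∂(volume : Measure (AddCircle P)),
    F t x = a (x, t) * u t x

theorem IsProduct.sub {a : AddCircle P × ℝ → ℝ} {u F u' F' : L2Time T (L2Torus P)}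
    (h : IsProduct a u F) (h' : IsProduct a u' F') : IsProduct a (u - u') (F - F') := by
  filter_upwards [h, h', Lp.coeFn_sub u u', Lp.coeFn_sub F F'] with t h1 h2 h3 h4
  rw [h3, h4, Pi.sub_apply, Pi.sub_apply]
  filter_upwards [h1, h2, Lp.coeFn_sub (u t) (u' t), Lp.coeFn_sub (F t) (F' t)]
    with x k1 k2 k3 k4
  rw [k3, k4, Pi.sub_apply, Pi.sub_apply, k1, k2, mul_sub]

theorem IsProduct.weightedSq_le {a : AddCircle P × ℝ → ℝ} {u F : L2Time T (L2Torus P)}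
    (h : IsProduct a u F) {M : ℝ}
    (ha : ∀ᵐ t ∂(volume.restrict (Ioo 0 T)), ∀ᵐ x ∂(volume : Measure (AddCircle P)),
      ‖a (x, t)‖ ≤ M) (γ : ℝ) : weightedSq γ F ≤ M ^ 2 * weightedSq γ u := by
  refine weightedSq_mono γ (M ^ 2) ?_
  filter_upwards [h, ha] with t h1 h2
  rw [← mul_pow]
  exact pow_le_pow_left₀ (norm_nonneg _) (norm_le_of_ae_eq_mul h2 h1) 2

theorem ae_ae_norm_le {a : AddCircle P × ℝ → ℝ} {M : ℝ}
    (ha : ∀ᵐ p ∂(volume.prod (volume.restrict (Ioo 0 T))), ‖a p‖ ≤ M) :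
    ∀ᵐ t ∂(volume.restrict (Ioo 0 T)), ∀ᵐ x ∂(volume : Measure (AddCircle P)),
      ‖a (x, t)‖ ≤ M :=
  ae_ae_of_ae_prod_swap (Q := fun p => ‖a p‖ ≤ M) ha

theorem exists_indicator_mul {W : Set (AddCircle P)} (hW : MeasurableSet W)
    (v : L2Time T (L2Torus P)) :
    ∃ g : L2Time T (L2Torus P), IsProduct (fun p => W.indicator 1 p.1) v g ∧ ‖g‖ ≤ ‖v‖ := by
  have hχ (x : AddCircle P) : ‖W.indicator (1 : AddCircle P → ℝ) x‖ ≤ 1 := by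
    by_cases hx : x ∈ W <;> simp [hx]
  have hχm : StronglyMeasurable fun p : AddCircle P × ℝ =>
      W.indicator (1 : AddCircle P → ℝ) p.1 :=
    (stronglyMeasurable_one.indicator hW).comp_measurable measurable_fst
  obtain ⟨g, hg⟩ : ∃ g, IsProduct (fun p => W.indicator (1 : AddCircle P → ℝ) p.1) v g :=
    exists_mul zero_le_one hχm.aestronglyMeasurable
      (Filter.Eventually.of_forall fun p => hχ p.1) v
  refine ⟨g, hg, ?_⟩
  have h1 : weightedSq 0 g ≤ 1 ^ 2 * weightedSq 0 v :=
    hg.weightedSq_le (Filter.Eventually.of_forall fun t => Filter.Eventually.of_forall hχ) 0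
  rw [weightedSq_zero, weightedSq_zero, one_pow, one_mul] at h1
  exact (sq_le_sq₀ (norm_nonneg _) (norm_nonneg _)).1 h1

/-- The equation with potential is the equation with the source `v χ_W - a β`. -/
theorem isBeamSolution_iff {W : Set (AddCircle P)} {a : AddCircle P × ℝ → ℝ}
    {v g F : L2Time T (L2Torus P)} {β₀ : HTorus P 3} {β₁ : HTorus P 1} {β : beamSpace P T}
    (hg : IsProduct (fun p => W.indicator 1 p.1) v g) (hF : IsProduct a (dt 0 (inH2L2 β)) F) :
    IsBeamSolution W a v β₀ β₁ β ↔ IsForcedSolution (g - F) β₀ β₁ β := by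
  -- The two equations are related by the pointwise values of the functions in them.
  have key : ∀ᵐ t ∂(volume.restrict (Ioo 0 T)),
      (∀ᵐ x ∂(volume : Measure (AddCircle P)),
        (dt 2 (inH2L2 β) t) x - (dx 2 (dt 1 (inH1H2 β) t)) x + (dx 4 (inL2H4 β t)) x
          + a (x, t) * (dx 0 (inL2H4 β t)) x = W.indicator (v t) x) ↔
      dt 2 (inH2L2 β) t - dx 2 (dt 1 (inH1H2 β) t) + dx 4 (inL2H4 β t) = (g - F) t := by
    filter_upwards [hg, hF, Lp.coeFn_sub g F, dx_zero_inL2H4 β] with t h1 h2 h3 h4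
    rw [h3, h4, Pi.sub_apply, Lp.ext_iff]
    refine Filter.eventually_congr ?_
    filter_upwards [h1, h2, Lp.coeFn_sub (g t) (F t),
      Lp.coeFn_add (dt 2 (inH2L2 β) t - dx 2 (dt 1 (inH1H2 β) t)) (dx 4 (inL2H4 β t)),
      Lp.coeFn_sub (dt 2 (inH2L2 β) t) (dx 2 (dt 1 (inH1H2 β) t))] with x k1 k2 k3 k4 k5
    have k6 : W.indicator (v t) x = W.indicator 1 x * v t x := by
      by_cases hx : x ∈ W <;> simp [hx]
    rw [k3, k4, Pi.add_apply, k5, Pi.sub_apply, Pi.sub_apply, k1, k2, k6]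
    constructor <;> intro h <;> linarith
  constructor
  · intro h
    refine ⟨?_, h.initial_displacement, h.initial_velocity⟩
    filter_upwards [key, h.equation] with t h1 h2
    exact h1.1 h2
  · intro h
    refine ⟨?_, h.initial_displacement, h.initial_velocity⟩
    filter_upwards [key, h.equation] with t h1 h2
    exact h1.2 h2

variable {a : AddCircle P × ℝ → ℝ} {M : ℝ} {β₀ : HTorus P 3} {β₁ : HTorus P 1}

/-- The map taking `u` to the solution with source `g - a u` contracts the norm with weight
`exp (-γ t)`, for `γ = 4 M² + 3`. -/
theorem IsForcedSolution.weightedSq_sub_le (hT : 0 < T)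
    (ha : ∀ᵐ t ∂(volume.restrict (Ioo 0 T)), ∀ᵐ x ∂(volume : Measure (AddCircle P)),
      ‖a (x, t)‖ ≤ M) {g u F u' F' : L2Time T (L2Torus P)} (hF : IsProduct a u F)
    (hF' : IsProduct a u' F') {β β' : beamSpace P T} (h : IsForcedSolution (g - F) β₀ β₁ β)
    (h' : IsForcedSolution (g - F') β₀ β₁ β') :
    weightedSq (4 * M ^ 2 + 3) (dt 0 (inH2L2 β) - dt 0 (inH2L2 β')) ≤
      1 / 4 * weightedSq (4 * M ^ 2 + 3) (u - u') := by
  set γ := 4 * M ^ 2 + 3 with hγ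
  have hd := (h.sub h').weightedSq_le hT (γ := γ) (by rw [hγ]; nlinarith [sq_nonneg M])
  have e1 : dt 0 (inH2L2 (β - β')) = dt 0 (inH2L2 β) - dt 0 (inH2L2 β') := rfl
  have e2 : g - F - (g - F') = -(F - F') := by abel
  rw [e1, e2, weightedSq_neg] at hd
  have hs := (hF.sub hF').weightedSq_le ha γ
  simp only [norm_zero, ne_eq, OfNat.ofNat_ne_zero, not_false_eq_true, zero_pow, zero_add] at hd
  have h0 := weightedSq_nonneg γ (u - u')
  have h1 : γ - 2 = 4 * M ^ 2 + 1 := by rw [hγ]; ring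
  rw [h1] at hd
  have hpos : 0 < 4 * M ^ 2 + 1 := by positivity
  refine le_of_mul_le_mul_left ?_ hpos
  linarith

/-- Existence for the equation with potential, by contraction. -/
theorem exists_isForcedSolution_potential (hT : 0 < T) (hM : 0 ≤ M)
    (ham : AEStronglyMeasurable a (volume.prod (volume.restrict (Ioo 0 T))))
    (ha : ∀ᵐ p ∂(volume.prod (volume.restrict (Ioo 0 T))), ‖a p‖ ≤ M)
    (g : L2Time T (L2Torus P)) (β₀ : HTorus P 3) (β₁ : HTorus P 1) :
    ∃ (β : beamSpace P T) (F : L2Time T (L2Torus P)), IsProduct a (dt 0 (inH2L2 β)) F ∧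
      IsForcedSolution (g - F) β₀ β₁ β := by
  have hA (u : L2Time T (L2Torus P)) : ∃ F, IsProduct a u F := exists_mul hM ham ha u
  obtain ⟨A, hA⟩ : ∃ A : L2Time T (L2Torus P) → L2Time T (L2Torus P),
      ∀ u, IsProduct a u (A u) := Classical.skolem.1 hA
  obtain ⟨S, hS⟩ : ∃ S : L2Time T (L2Torus P) → beamSpace P T,
      ∀ f, IsForcedSolution f β₀ β₁ (S f) :=
    Classical.skolem.1 fun f => exists_isForcedSolution hT f β₀ β₁
  have hc (u u' : L2Time T (L2Torus P)) :
      weightedSq (4 * M ^ 2 + 3)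
          (dt 0 (inH2L2 (S (g - A u))) - dt 0 (inH2L2 (S (g - A u')))) ≤
        1 / 4 * weightedSq (4 * M ^ 2 + 3) (u - u') :=
    IsForcedSolution.weightedSq_sub_le hT (ae_ae_norm_le ha) (hA u) (hA u')
      (hS (g - A u)) (hS (g - A u'))
  obtain ⟨u, hu⟩ := exists_fixedPoint_of_weightedSq (by positivity)
    (fun u => dt 0 (inH2L2 (S (g - A u)))) hc
  have hu' : dt 0 (inH2L2 (S (g - A u))) = u := hu
  exact ⟨S (g - A u), A u, by rw [hu']; exact hA u, hS _⟩

/-- Uniqueness for the equation with potential. -/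
theorem IsForcedSolution.eq_of_potential (hT : 0 < T)
    (ha : ∀ᵐ t ∂(volume.restrict (Ioo 0 T)), ∀ᵐ x ∂(volume : Measure (AddCircle P)),
      ‖a (x, t)‖ ≤ M) {g F F' : L2Time T (L2Torus P)} {β β' : beamSpace P T}
    (hF : IsProduct a (dt 0 (inH2L2 β)) F) (hF' : IsProduct a (dt 0 (inH2L2 β')) F')
    (h : IsForcedSolution (g - F) β₀ β₁ β) (h' : IsForcedSolution (g - F') β₀ β₁ β') :
    β = β' := by
  have h1 := IsForcedSolution.weightedSq_sub_le hT ha hF hF' h h'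
  have h2 := weightedSq_nonneg (4 * M ^ 2 + 3) (dt 0 (inH2L2 β) - dt 0 (inH2L2 β'))
  have h3 := norm_sq_le_weightedSq (4 * M ^ 2 + 3) (by positivity)
    (dt 0 (inH2L2 β) - dt 0 (inH2L2 β'))
  have h4 : weightedSq (4 * M ^ 2 + 3) (dt 0 (inH2L2 β) - dt 0 (inH2L2 β')) = 0 := by linarith
  rw [h4, mul_zero] at h3
  have h5 : ‖dt 0 (inH2L2 β) - dt 0 (inH2L2 β')‖ = 0 := by
    have := sq_nonneg ‖dt 0 (inH2L2 β) - dt 0 (inH2L2 β')‖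
    exact pow_eq_zero_iff two_ne_zero |>.1 (le_antisymm h3 this)
  exact beamSpace_ext (sub_eq_zero.1 (norm_eq_zero.1 h5))

/-- The a priori estimate for the equation with potential: the weight absorbs the potential. -/
theorem IsForcedSolution.beamNorm_le_of_potential (hT : 0 < T)
    (ha : ∀ᵐ t ∂(volume.restrict (Ioo 0 T)), ∀ᵐ x ∂(volume : Measure (AddCircle P)),
      ‖a (x, t)‖ ≤ M) {g F : L2Time T (L2Torus P)} {β : beamSpace P T}
    (hF : IsProduct a (dt 0 (inH2L2 β)) F) (h : IsForcedSolution (g - F) β₀ β₁ β) {C₀ : ℝ}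
    (hg : ‖g‖ ≤ C₀ * (‖β₀‖ + ‖β₁‖)) :
    beamNorm β ≤ 5 * √(regularityConst T * (1 + 2 * C₀ ^ 2 +
      2 * M ^ 2 * Real.exp ((4 * M ^ 2 + 3) * T) * (1 + 2 * C₀ ^ 2))) * (‖β₀‖ + ‖β₁‖) := by
  set γ := 4 * M ^ 2 + 3 with hγ
  set N := ‖β₀‖ + ‖β₁‖ with hN
  have hN0 : 0 ≤ N := by positivity
  have hγ0 : 0 ≤ γ := by positivity
  have hD : ‖β₀‖ ^ 2 + ‖β₁‖ ^ 2 ≤ N ^ 2 := by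
    have := mul_nonneg (norm_nonneg β₀) (norm_nonneg β₁)
    rw [hN]; nlinarith
  have hg2 : ‖g‖ ^ 2 ≤ C₀ ^ 2 * N ^ 2 := by
    rw [← mul_pow]; exact pow_le_pow_left₀ (norm_nonneg _) hg 2
  have hsplit (δ : ℝ) : weightedSq δ (g - F) ≤
      2 * weightedSq δ g + 2 * (M ^ 2 * weightedSq δ (dt 0 (inH2L2 β))) := by
    have h1 := weightedSq_add_le δ g (-F)
    rw [weightedSq_neg, ← sub_eq_add_neg] at h1
    linarith [hF.weightedSq_le ha δ]
  have hw := h.weightedSq_le hT (γ := γ) (by rw [hγ]; nlinarith [sq_nonneg M])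
  have hU0 := weightedSq_nonneg γ (dt 0 (inH2L2 β))
  have hU : weightedSq γ (dt 0 (inH2L2 β)) ≤ (1 + 2 * C₀ ^ 2) * N ^ 2 := by
    have h1 := hsplit γ
    have h2 := weightedSq_le_norm_sq γ hγ0 g
    have h3 : γ - 2 = 4 * M ^ 2 + 1 := by rw [hγ]; ring
    rw [h3] at hw
    have h4 := mul_nonneg (sq_nonneg M) hU0
    linarith
  have hf : ‖g - F‖ ^ 2 ≤ 2 * C₀ ^ 2 * N ^ 2 +
      2 * M ^ 2 * (Real.exp (γ * T) * ((1 + 2 * C₀ ^ 2) * N ^ 2)) := by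
    have h1 := hsplit 0
    rw [weightedSq_zero, weightedSq_zero, weightedSq_zero] at h1
    have h2 : ‖dt 0 (inH2L2 β)‖ ^ 2 ≤ Real.exp (γ * T) * ((1 + 2 * C₀ ^ 2) * N ^ 2) :=
      (norm_sq_le_weightedSq γ hγ0 _).trans
        (mul_le_mul_of_nonneg_left hU (Real.exp_pos _).le)
    have h3 := mul_le_mul_of_nonneg_left h2 (sq_nonneg M)
    linarith
  refine (h.beamNorm_le hT).trans ?_
  rw [mul_assoc]
  refine mul_le_mul_of_nonneg_left ?_ (by norm_num)
  refine le_trans (Real.sqrt_le_sqrt (y := regularityConst T * (1 + 2 * C₀ ^ 2 +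
    2 * M ^ 2 * Real.exp (γ * T) * (1 + 2 * C₀ ^ 2)) * N ^ 2) ?_)
    (by rw [Real.sqrt_mul' _ (sq_nonneg N), Real.sqrt_sq hN0])
  rw [mul_assoc]
  refine mul_le_mul_of_nonneg_left ?_ (regularityConst_pos T).le
  linarith

end Potential

theorem isOpen_controlZone (d L : ℝ) : IsOpen (controlZone d L) :=
  QuotientAddGroup.isOpenMap_coe _ (isOpen_Ioo.union isOpen_Ioo)

end DampedBeam

open DampedBeam
theorem lemma1p3 (d L T : ℝ) [Fact (0 < d)] [Fact (0 < L)] (hT : 0 < T)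
    (M C₀ : ℝ) (hM : 0 ≤ M) (hC₀ : 0 < C₀) :
    ∃ C : ℝ, 0 < C ∧
      ∀ a : AddCircle (d + 2 * L) × ℝ → ℝ,
        MemLp a ∞ (volume.prod (volume.restrict (Ioo 0 T))) →
        eLpNorm a ∞ (volume.prod (volume.restrict (Ioo 0 T))) ≤ ENNReal.ofReal M →
      ∀ (β₀ : HTorus (d + 2 * L) 3) (β₁ : HTorus (d + 2 * L) 1)
        (v : L2Time T (L2Torus (d + 2 * L))),
        ‖v‖ ≤ C₀ * (‖β₀‖ + ‖β₁‖) →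
        (∃! β : beamSpace (d + 2 * L) T, IsBeamSolution (controlZone d L) a v β₀ β₁ β) ∧
        ∀ β : beamSpace (d + 2 * L) T, IsBeamSolution (controlZone d L) a v β₀ β₁ β →
          beamNorm β ≤ C * (‖β₀‖ + ‖β₁‖) := by
  refine ⟨5 * √(regularityConst T * (1 + 2 * C₀ ^ 2 +
    2 * M ^ 2 * Real.exp ((4 * M ^ 2 + 3) * T) * (1 + 2 * C₀ ^ 2))), ?_, ?_⟩
  · have := regularityConst_pos T
    positivity
  intro a ha haM β₀ β₁ v hv
  have hb : ∀ᵐ p ∂(volume.prod (volume.restrict (Ioo 0 T))), ‖a p‖ ≤ M := by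
    rw [eLpNorm_exponent_top] at haM
    filter_upwards [enorm_ae_le_eLpNormEssSup a (volume.prod (volume.restrict (Ioo 0 T)))]
      with p hp
    have := hp.trans haM
    rwa [← ofReal_norm, ENNReal.ofReal_le_ofReal_iff hM] at this
  obtain ⟨g, hg, hgv⟩ := exists_indicator_mul (isOpen_controlZone d L).measurableSet v
  refine ⟨?_, fun β hβ => ?_⟩
  · obtain ⟨β, F, hF, hβ⟩ := exists_isForcedSolution_potential hT hM ha.aestronglyMeasurable hb g
      β₀ β₁
    refine ⟨β, (isBeamSolution_iff hg hF).2 hβ, fun β' hβ' => ?_⟩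
    obtain ⟨F', hF'⟩ := exists_mul hM ha.aestronglyMeasurable hb (dt 0 (inH2L2 β'))
    exact IsForcedSolution.eq_of_potential hT (ae_ae_norm_le hb) hF' hF
      ((isBeamSolution_iff hg hF').1 hβ') hβ
  · obtain ⟨F, hF⟩ := exists_mul hM ha.aestronglyMeasurable hb (dt 0 (inH2L2 β))
    exact ((isBeamSolution_iff hg hF).1 hβ).beamNorm_le_of_potential hT (ae_ae_norm_le hb) hF
      (hgv.trans hv)
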